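/- Let $l\ge 0$ and let $\mathbf t=(t_1,t_2,\dots,t_{2l})$ be a sequence of non-negative integers. Put $E=\sum_{i=1}^{l}t_{2i}$, $O=\sum_{i=1}^{l}t_{2i-1}$ and $s_k=t_1+\cdots+t_k$. Let $\operatorname{H}(n)=0!\,1!\,2!\cdots(n-1)!$, and let $\operatorname{H}_2(n)=0!\,2!\,4!\cdots(n-2)!$ for even $n$ and $\operatorname{H}_2(n)=1!\,3!\,5!\cdots(n-2)!$ for odd $n$; empty products are $1$, in particular $\operatorname{H}(0)=\operatorname{H}(-1)=\operatorname{H}_2(0)=\operatorname{H}_2(1)=\operatorname{H}_2(-1)=1$. On the triangular lattice with horizontal lattice lines, a lozenge is the union of two unit triangles that share an edge; it is vertical if the shared edge is horizontal. A lozenge tiling of a region is a covering of the region by lozenges without gaps or overlaps. Region $\mathcal Q(\mathbf t)$: take the trapezoidal region whose northern, northeastern and southern sides have lengths $O$, $2E$ and $E+O$, and whose western side is the vertical zigzag lattice path with $2E$ unit edges which, going up from the southwestern corner, alternates northwest and northeast steps, beginning with a northwest step. Remove from it the $l$ up-pointing triangles standing on the southern side whose bases, from left to right, are the segments from $s_{2i-1}$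 to $s_{2i}$ (measured from the southwestern corner), $i=1,\dots,l$; so the triangles have sides $t_2,t_4,\dots,t_{2l}$ and the gaps before them have lengths $t_1,t_3,\dots,t_{2l-1}$. Region $\mathcal K(\mathbf t)$: the same, with northeastern side of length $2E-1$ and with western side the vertical zigzag with $2E-1$ unit edges which, going up from the southwestern corner, begins with a northeast step (if $E=0$, $\mathcal K(\mathbf t)$ is the empty region, which has exactly one tiling). Let $\operatorname{Q}(\mathbf t)$ and $\operatorname{K}(\mathbf t)$ be the numbers of lozenge tilings of $\mathcal Q(\mathbf t)$ and $\mathcal K(\mathbf t)$. Let $\operatorname{Q}'(\mathbf t)$ and $\operatorname{K}'(\mathbf t)$ be the corresponding weighted counts, in which every vertical lozenge whose two western edges run along the western zigzag has weight $\frac12$, every other lozenge has weight $1$, the weight of a tiling is the product of the weights of its lozenges, and the weights of all tilings are added. Then \begin{align*} \operatorname{Q}(\mathbf t)&=\frac{\prod_{i=1}^{l}\frac{s_{2i}!}{s_{2i-1}!}}{\operatorname{H}_2(2E+1)}\prod_{i=1}^{l}\frac{\operatorname{H}_2(2s_{2i}+1)\operatorname{H}(2s_{2i-1}+2)}{\operatorname{H}_2(2s_{2i-1}+3)}\prod_{\substack{1\le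 i<j\le 2l\\ j-i\text{ odd}}}\frac{\operatorname{H}(s_j-s_i)}{\operatorname{H}(s_j+s_i+1)}\prod_{\substack{1\le i<j\le 2l\\ j-i\text{ even}}}\frac{\operatorname{H}(s_j+s_i+1)}{\operatorname{H}(s_j-s_i)},\\ \operatorname{Q}'(\mathbf t)&=\frac{2^{-E}}{\operatorname{H}_2(2E+1)}\prod_{i=1}^{l}\frac{\operatorname{H}_2(2s_{2i}+1)\operatorname{H}(2s_{2i-1})}{\operatorname{H}_2(2s_{2i-1}+1)}\prod_{\substack{1\le i<j\le 2l\\ j-i\text{ odd}}}\frac{\operatorname{H}(s_j-s_i)}{\operatorname{H}(s_j+s_i)}\prod_{\substack{1\le i<j\le 2l\\ j-i\text{ even}}}\frac{\operatorname{H}(s_j+s_i)}{\operatorname{H}(s_j-s_i)},\\ \operatorname{K}(\mathbf t)&=\frac{1}{\operatorname{H}_2(2E)}\prod_{i=1}^{l}\frac{\operatorname{H}_2(2s_{2i})\operatorname{H}(2s_{2i-1}+1)}{\operatorname{H}_2(2s_{2i-1}+2)}\prod_{\substack{1\le i<j\le 2l\\ j-i\text{ odd}}}\frac{\operatorname{H}(s_j-s_i)}{\operatorname{H}(s_j+s_i)}\prod_{\substack{1\le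 i<j\le 2l\\ j-i\text{ even}}}\frac{\operatorname{H}(s_j+s_i)}{\operatorname{H}(s_j-s_i)},\\ \operatorname{K}'(\mathbf t)&=\frac{1}{\operatorname{H}_2(2E)}\prod_{i=1}^{l}\frac{\operatorname{H}_2(2s_{2i}-1)\operatorname{H}(2s_{2i-1})}{\operatorname{H}_2(2s_{2i-1}+1)}\prod_{\substack{1\le i<j\le 2l\\ j-i\text{ odd}}}\frac{\operatorname{H}(s_j-s_i)}{\operatorname{H}(s_j+s_i-1)}\prod_{\substack{1\le i<j\le 2l\\ j-i\text{ even}}}\frac{\operatorname{H}(s_j+s_i-1)}{\operatorname{H}(s_j-s_i)}. \end{align*} -/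

import Mathlib

namespace QuarteredHexagon

open Finset

noncomputable section

/-! The triangular lattice.  The pair `(x, y) : ℤ × ℤ` stands for the lattice point
`x • (1, 0) + y • (1/2, √3/2)` of the plane. -/

/-- A unit triangle of the triangular lattice: `(x, y, true)` is the up-pointing triangle whose
horizontal (bottom) side joins `(x, y)` and `(x + 1, y)`, and `(x, y, false)` is the down-pointing
triangle whose horizontal (top) side joins `(x, y + 1)` and `(x + 1, y + 1)`. -/
abbrev Tri := ℤ × ℤ × Bool

/-- The three lattice points that are the vertices of a unit triangle. -/
def verts : Tri → Finset (ℤ × ℤ)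
  | (x, y, true) => {(x, y), (x + 1, y), (x, y + 1)}
  | (x, y, false) => {(x + 1, y), (x, y + 1), (x + 1, y + 1)}

/-- Two unit triangles share an edge: they have exactly two vertices in common. -/
def ShareEdge (p q : Tri) : Prop := #(verts p ∩ verts q) = 2

instance (p q : Tri) : Decidable (ShareEdge p q) := by unfold ShareEdge; infer_instance

/-- The lozenges contained in a finite region `R` (a finite set of unit triangles): the unions of
two unit triangles of `R` that share an edge. -/
def lozenges (R : Finset Tri) : Finset (Finset Tri) :=
  {p ∈ R ×ˢ R | ShareEdge p.1 p.2}.image fun p => {p.1, p.2}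

/-- The lozenge tilings of `R`: sets of lozenges in `R` without overlaps and without gaps. -/
def tilings (R : Finset Tri) : Finset (Finset (Finset Tri)) :=
  {T ∈ (lozenges R).powerset |
    (∀ a ∈ T, ∀ b ∈ T, a ≠ b → Disjoint a b) ∧ T.biUnion id = R}

/-- The sum of the weights of all tilings of `R`; the weight of a tiling is the product of the
weights of its lozenges. -/
def weightedCount (w : Finset Tri → ℚ) (R : Finset Tri) : ℚ :=
  ∑ T ∈ tilings R, ∏ a ∈ T, w a

/-- The trapezoidal region of height `m` (in rows of unit triangles), with southern side from
`(0, 0)` to `(N, 0)`, with straight northeastern side from `(N, 0)` to `(N - m, m)`, and with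
western side the lattice path through the points `(west y, y)`, `0 ≤ y ≤ m`.
A unit triangle lies in a single row, so it lies in the region iff its vertices do.
(The first coordinates of the triangles are searched in `[-m, N]`, which is enough
for the two western sides below.) -/
def trapezoid (west : ℤ → ℤ) (m N : ℕ) : Finset Tri :=
  {p ∈ Icc (-(m : ℤ)) N ×ˢ Ico (0 : ℤ) m ×ˢ (univ : Finset Bool) |
    ∀ v ∈ verts p, 0 ≤ v.2 ∧ v.2 ≤ m ∧ v.1 + v.2 ≤ N ∧ west v.2 ≤ v.1}

/-- A unit triangle lies in the up-pointing triangle of side `k` whose base joins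
`(a, 0)` and `(a + k, 0)`. -/
def InBaseTriangle (a k : ℕ) (p : Tri) : Prop :=
  ∀ v ∈ verts p, 0 ≤ v.2 ∧ (a : ℤ) ≤ v.1 ∧ v.1 + v.2 ≤ (a : ℤ) + k

instance (a k : ℕ) (p : Tri) : Decidable (InBaseTriangle a k p) := by
  unfold InBaseTriangle; infer_instance

/-- The vertical zigzag that starts at `(0, 0)` with a step to the northwest:
at height `y` its horizontal position in the plane is `0` for even `y` and `-1/2` for odd `y`. -/
def westQ (y : ℤ) : ℤ := -((y + 1) / 2)

/-- The vertical zigzag that starts at `(0, 0)` with a step to the northeast: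
at height `y` its horizontal position in the plane is `0` for even `y` and `1/2` for odd `y`. -/
def westK (y : ℤ) : ℤ := -(y / 2)

/-- The vertical lozenges on the western side have weight `1/2`, all other lozenges weight `1`.
The vertical lozenge with western vertex `(west y, y)` is on the western side if its two western
edges run along the zigzag, i.e. if the zigzag passes through `(west y + 1, y - 1)`,
`(west y, y)` and `(west y, y + 1)`. -/
def westWeight (west : ℤ → ℤ) (m : ℕ) (a : Finset Tri) : ℚ :=
  if ∃ y ∈ Ioo (0 : ℤ) m, west (y - 1) = west y + 1 ∧ west (y + 1) = west y ∧
      a = {(west y, y - 1, false), (west y, y, true)}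
  then 1 / 2 else 1

section Sequences

variable {l : ℕ} (t : Fin (2 * l) → ℕ)

/-- The entry `t_{j+1}` of `t = (t_1, …, t_{2l})` is `t j`; this is the partial sum
`s_k = t_1 + ⋯ + t_k`. -/
def psum (k : ℕ) : ℕ := ∑ j with j.val < k, t j

/-- `t_2 + t_4 + ⋯ + t_{2l}` -/
def evenSum : ℕ := ∑ i : Fin l, t ⟨2 * i.val + 1, by omega⟩

/-- `t_1 + t_3 + ⋯ + t_{2l-1}` -/
def oddSum : ℕ := ∑ i : Fin l, t ⟨2 * i.val, by omega⟩

/-- Remove from `R` the up-pointing triangles of sides `t_2, t_4, …, t_{2l}` standing on the base,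
from left to right, where the gap before the triangle of side `t_{2i}` has length `t_{2i-1}`. -/
def removeTriangles (R : Finset Tri) : Finset Tri :=
  {p ∈ R | ∀ i : Fin l,
    ¬ InBaseTriangle (psum t (2 * i.val + 1)) (t ⟨2 * i.val + 1, by omega⟩) p}

/-- The region `𝒬(t)`: southern side `E + O`, northeastern side `2E`, northern side `O`. -/
def regionQ : Finset Tri :=
  removeTriangles t (trapezoid westQ (2 * evenSum t) (evenSum t + oddSum t))

/-- The region `𝒦(t)`: southern side `E + O`, northeastern side `2E - 1`, northern side `O`
(the empty region if `E = 0`). -/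
def regionK : Finset Tri :=
  removeTriangles t (trapezoid westK (2 * evenSum t - 1) (evenSum t + oddSum t))

/-- The number of lozenge tilings of `𝒬(t)`. -/
def tilingsQ : ℕ := #(tilings (regionQ t))

/-- The weighted number of lozenge tilings of `𝒬'(t)`. -/
def weightedTilingsQ : ℚ := weightedCount (westWeight westQ (2 * evenSum t)) (regionQ t)

/-- The number of lozenge tilings of `𝒦(t)`. -/
def tilingsK : ℕ := #(tilings (regionK t))

/-- The weighted number of lozenge tilings of `𝒦'(t)`. -/
def weightedTilingsK : ℚ := weightedCount (westWeight westK (2 * evenSum t - 1)) (regionK t)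

end Sequences

/-- The hyperfactorial `H(n) = 0! 1! ⋯ (n-1)!`. -/
def hyper (n : ℕ) : ℕ := ∏ i ∈ range n, i.factorial

/-- The skipping hyperfactorial: `0! 2! 4! ⋯ (n-2)!` for even `n`, `1! 3! 5! ⋯ (n-2)!` for odd
`n`. -/
def hyperSkip (n : ℕ) : ℕ := ∏ i ∈ range (n / 2), (2 * i + n % 2).factorial

/-- The pairs `(i, j)` with `1 ≤ i < j ≤ n` and `j - i` odd. -/
def oddPairs (n : ℕ) : Finset (ℕ × ℕ) :=
  {p ∈ Icc 1 n ×ˢ Icc 1 n | p.1 < p.2 ∧ Odd (p.2 - p.1)}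

/-- The pairs `(i, j)` with `1 ≤ i < j ≤ n` and `j - i` even. -/
def evenPairs (n : ℕ) : Finset (ℕ × ℕ) :=
  {p ∈ Icc 1 n ×ˢ Icc 1 n | p.1 < p.2 ∧ Even (p.2 - p.1)}

end

end QuarteredHexagon

/-!
If only the up-pointing unit triangles along the base of a removed triangle are missing, the rest of
that triangle is forced to be covered by vertical lozenges. So the region may be replaced by a
trapezoid with dents in its lowest row, which fill a union of intervals.

In a tiling of a dented trapezoid, the lowest row has one vertical lozenge before each dent, and the
upper halves of these lozenges are dents in the next row. Suppose that the count for the next row is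
a determinant whose row `i` depends only on the `i`-th dent. Then summing over the positions of the
vertical lozenges sums every row of the determinant over the gap before the corresponding dent. If
the entries are central factorials these sums telescope, because the central difference of
`x ^ [n] / n!` is `x ^ [n - 1] / (n - 1)!`. The weights of the western lozenges only shift the
variable: they are such that the sum from the western side has no constant term. Up to a factor `x`,
central factorials are polynomials in `x ^ 2`, so the determinant is a Vandermonde determinant in
the squares of the shifted dents.

Such a product over a union of intervals is expressed through the ends of the intervals by
lengthening the last interval one unit at a time.
-/

namespace QuarteredHexagon

open Finset

/-! ### Tilings of regions of the triangular lattice -/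

theorem mem_verts_up {x y : ℤ} {v : ℤ × ℤ} :
    v ∈ verts (x, y, true) ↔ v = (x, y) ∨ v = (x + 1, y) ∨ v = (x, y + 1) := by
  simp [verts]

theorem mem_verts_down {x y : ℤ} {v : ℤ × ℤ} :
    v ∈ verts (x, y, false) ↔ v = (x + 1, y) ∨ v = (x, y + 1) ∨ v = (x + 1, y + 1) := by
  simp [verts]

theorem card_verts (p : Tri) : #(verts p) = 3 := by
  obtain ⟨x, y, b⟩ := p
  cases b <;> exact card_eq_three.2 ⟨_, _, _, by simp, by simp, by simp, rfl⟩

theorem ShareEdge.symm {p q : Tri} (h : ShareEdge p q) : ShareEdge q p := by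
  rwa [ShareEdge, inter_comm]

theorem shareEdge_comm {p q : Tri} : ShareEdge p q ↔ ShareEdge q p :=
  ⟨ShareEdge.symm, ShareEdge.symm⟩

theorem ShareEdge.ne {p q : Tri} (h : ShareEdge p q) : p ≠ q := by
  rintro rfl
  simp [ShareEdge, card_verts] at h

theorem ShareEdge.exists_common_verts {p q : Tri} (h : ShareEdge p q) :
    ∃ u w : ℤ × ℤ, u ≠ w ∧ (u ∈ verts p ∧ u ∈ verts q) ∧ w ∈ verts p ∧ w ∈ verts q := by
  obtain ⟨u, hu, w, hw, hne⟩ := one_lt_card.1 (lt_of_lt_of_eq one_lt_two (Eq.symm h))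
  exact ⟨u, w, hne, mem_inter.1 hu, mem_inter.1 hw⟩

theorem not_shareEdge_of_same_orientation (x y x' y' : ℤ) (b : Bool) :
    ¬ ShareEdge (x, y, b) (x', y', b) := by
  intro h
  obtain ⟨⟨u₁, u₂⟩, ⟨w₁, w₂⟩, huw, hu, hw⟩ := h.exists_common_verts
  have hne := h.ne
  cases b <;>
    simp only [mem_verts_up, mem_verts_down, ne_eq, Prod.mk.injEq, and_true] at hne huw hu hw <;>
    omega

theorem shareEdge_up_down {x y x' y' : ℤ} :
    ShareEdge (x, y, true) (x', y', false) ↔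
      (x' = x ∧ y' = y) ∨ (x' = x - 1 ∧ y' = y) ∨ (x' = x ∧ y' = y - 1) := by
  constructor
  · intro h
    obtain ⟨⟨u₁, u₂⟩, ⟨w₁, w₂⟩, huw, hu, hw⟩ := h.exists_common_verts
    simp only [mem_verts_up, mem_verts_down, ne_eq, Prod.mk.injEq] at huw hu hw
    omega
  · have shareEdge_of_inter {u w : ℤ × ℤ} (hne : u ≠ w)
        (hinter : ∀ a b, (a, b) ∈ verts (x, y, true) ∧ (a, b) ∈ verts (x', y', false) ↔
          (a, b) = u ∨ (a, b) = w) : ShareEdge (x, y, true) (x', y', false) :=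
      card_eq_two.2 ⟨u, w, hne, by ext ⟨a, b⟩; simpa using hinter a b⟩
    rintro (⟨rfl, rfl⟩ | ⟨rfl, rfl⟩ | ⟨rfl, rfl⟩)
    · refine shareEdge_of_inter (u := (x' + 1, y')) (w := (x', y' + 1)) (by simp) fun a b => ?_
      simp only [mem_verts_up, mem_verts_down, Prod.mk.injEq]
      omega
    · refine shareEdge_of_inter (u := (x, y')) (w := (x, y' + 1)) (by simp) fun a b => ?_
      simp only [mem_verts_up, mem_verts_down, Prod.mk.injEq]
      omega
    · refine shareEdge_of_inter (u := (x', y)) (w := (x' + 1, y)) (by simp) fun a b => ?_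
      simp only [mem_verts_up, mem_verts_down, Prod.mk.injEq]
      omega

theorem shareEdge_down_up {x y x' y' : ℤ} :
    ShareEdge (x, y, false) (x', y', true) ↔
      (x' = x ∧ y' = y) ∨ (x' = x + 1 ∧ y' = y) ∨ (x' = x ∧ y' = y + 1) := by
  rw [shareEdge_comm, shareEdge_up_down]
  omega

theorem mem_lozenges {R a : Finset Tri} :
    a ∈ lozenges R ↔ ∃ p ∈ R, ∃ q ∈ R, ShareEdge p q ∧ a = {p, q} := by
  simp only [lozenges, mem_image, mem_filter, mem_product, Prod.exists]
  grind

theorem pair_mem_lozenges {R : Finset Tri} {p q : Tri} (hp : p ∈ R) (hq : q ∈ R)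
    (h : ShareEdge p q) : {p, q} ∈ lozenges R :=
  mem_lozenges.2 ⟨p, hp, q, hq, h, rfl⟩

theorem subset_of_mem_lozenges {R a : Finset Tri} (h : a ∈ lozenges R) : a ⊆ R := by
  obtain ⟨p, hp, q, hq, -, rfl⟩ := mem_lozenges.1 h
  simp [insert_subset_iff, hp, hq]

theorem nonempty_of_mem_lozenges {R a : Finset Tri} (h : a ∈ lozenges R) : a.Nonempty := by
  obtain ⟨p, -, q, -, -, rfl⟩ := mem_lozenges.1 h
  exact insert_nonempty p {q}

theorem mem_lozenges_sdiff {R L a : Finset Tri} :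
    a ∈ lozenges (R \ L) ↔ a ∈ lozenges R ∧ Disjoint a L := by
  constructor
  · intro h
    refine ⟨?_, disjoint_of_subset_left (subset_of_mem_lozenges h) sdiff_disjoint⟩
    obtain ⟨p, hp, q, hq, hpq, rfl⟩ := mem_lozenges.1 h
    exact pair_mem_lozenges (mem_sdiff.1 hp).1 (mem_sdiff.1 hq).1 hpq
  · rintro ⟨h, hdisj⟩
    obtain ⟨p, hp, q, hq, hpq, rfl⟩ := mem_lozenges.1 h
    rw [disjoint_left] at hdisj
    exact pair_mem_lozenges (mem_sdiff.2 ⟨hp, hdisj (by simp)⟩)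
      (mem_sdiff.2 ⟨hq, hdisj (by simp)⟩) hpq

theorem exists_pair_of_mem_lozenges {R a : Finset Tri} {p : Tri} (h : a ∈ lozenges R)
    (hp : p ∈ a) : ∃ q ∈ R, ShareEdge p q ∧ a = {p, q} := by
  obtain ⟨r, hr, s, hs, hrs, rfl⟩ := mem_lozenges.1 h
  obtain rfl | rfl : p = r ∨ p = s := by simpa using hp
  · exact ⟨s, hs, hrs, rfl⟩
  · exact ⟨r, hr, hrs.symm, pair_comm _ _⟩

theorem mem_tilings {R : Finset Tri} {T : Finset (Finset Tri)} :
    T ∈ tilings R ↔ (∀ a ∈ T, a ∈ lozenges R) ∧ (∀ a ∈ T, ∀ b ∈ T, a ≠ b → Disjoint a b) ∧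
      T.biUnion id = R := by
  simp only [tilings, mem_filter, mem_powerset, subset_iff]

theorem tilings_empty : tilings ∅ = {∅} := by
  ext T
  simp only [mem_tilings, mem_singleton, lozenges, empty_product, filter_empty, image_empty,
    notMem_empty]
  constructor
  · rintro ⟨hT, -⟩
    exact eq_empty_of_forall_notMem hT
  · rintro rfl
    simp

theorem erase_mem_tilings {R L : Finset Tri} {T : Finset (Finset Tri)} (hT : T ∈ tilings R)
    (hL : L ∈ T) : T.erase L ∈ tilings (R \ L) := by
  obtain ⟨hloz, hdisj, hcover⟩ := mem_tilings.1 hT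
  refine mem_tilings.2 ⟨fun a ha => ?_, fun a ha b hb => hdisj a (mem_of_mem_erase ha) b
    (mem_of_mem_erase hb), ?_⟩
  · obtain ⟨hne, haT⟩ := mem_erase.1 ha
    exact mem_lozenges_sdiff.2 ⟨hloz a haT, hdisj a haT L hL hne⟩
  · have hLT : Disjoint L ((T.erase L).biUnion id) :=
      disjoint_biUnion_right _ _ _ |>.2 fun a ha =>
        hdisj L hL a (mem_of_mem_erase ha) (ne_of_mem_erase ha).symm
    rw [← hcover, ← insert_erase hL, biUnion_insert, id, erase_insert_eq_erase,
      union_sdiff_cancel_left (by simpa using hLT)]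
    simp

theorem insert_mem_tilings {R L : Finset Tri} {T : Finset (Finset Tri)} (hL : L ∈ lozenges R)
    (hT : T ∈ tilings (R \ L)) : L ∉ T ∧ insert L T ∈ tilings R := by
  obtain ⟨hloz, hdisj, hcover⟩ := mem_tilings.1 hT
  have hdisjL : ∀ a ∈ T, Disjoint a L := fun a ha => (mem_lozenges_sdiff.1 (hloz a ha)).2
  refine ⟨fun h => (nonempty_of_mem_lozenges hL).ne_empty (disjoint_self.1 (hdisjL L h)),
    mem_tilings.2 ⟨fun a ha => ?_, fun a ha b hb hab => ?_, ?_⟩⟩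
  · rcases mem_insert.1 ha with rfl | ha
    · exact hL
    · exact (mem_lozenges_sdiff.1 (hloz a ha)).1
  · rcases mem_insert.1 ha with haL | haT <;> rcases mem_insert.1 hb with hbL | hbT
    · exact absurd (haL.trans hbL.symm) hab
    · exact haL ▸ (hdisjL b hbT).symm
    · exact hbL ▸ hdisjL a haT
    · exact hdisj a haT b hbT hab
  · rw [biUnion_insert, hcover, id, union_sdiff_of_subset (subset_of_mem_lozenges hL)]

theorem existsUnique_partner {R : Finset Tri} {T : Finset (Finset Tri)} (hT : T ∈ tilings R)
    {p : Tri} (hp : p ∈ R) : ∃! q, q ∈ R ∧ ShareEdge p q ∧ {p, q} ∈ T := by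
  obtain ⟨hloz, hdisj, hcover⟩ := mem_tilings.1 hT
  obtain ⟨a, ha, hpa⟩ : ∃ a ∈ T, p ∈ a := by
    rw [← hcover] at hp
    simpa using hp
  obtain ⟨q, hq, hpq, rfl⟩ := exists_pair_of_mem_lozenges (hloz a ha) hpa
  refine ⟨q, ⟨hq, hpq, ha⟩, ?_⟩
  rintro r ⟨-, hpr, hr⟩
  have hrq : ({p, r} : Finset Tri) = {p, q} := by
    by_contra hne
    exact disjoint_left.1 (hdisj _ hr _ ha hne) (mem_insert_self p _) (mem_insert_self p _)
  have : r ∈ ({p, q} : Finset Tri) := hrq ▸ mem_insert_of_mem (mem_singleton_self r)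
  simpa [hpr.ne.symm] using this

theorem weightedCount_empty (w : Finset Tri → ℚ) : weightedCount w ∅ = 1 := by
  simp [weightedCount, tilings_empty]

theorem card_tilings_eq_weightedCount (R : Finset Tri) :
    (#(tilings R) : ℚ) = weightedCount (fun _ => 1) R := by
  simp [weightedCount]

theorem sum_tilings_containing (w : Finset Tri → ℚ) {R L : Finset Tri} (hL : L ∈ lozenges R) :
    ∑ T ∈ tilings R with L ∈ T, ∏ a ∈ T, w a = w L * weightedCount w (R \ L) := by
  rw [weightedCount, mul_sum]
  refine sum_bij' (fun T _ => T.erase L) (fun T _ => insert L T)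
    (fun T hT => erase_mem_tilings (mem_filter.1 hT).1 (mem_filter.1 hT).2)
    (fun T hT => mem_filter.2 ⟨(insert_mem_tilings hL hT).2, mem_insert_self _ _⟩)
    (fun T hT => insert_erase (mem_filter.1 hT).2)
    (fun T hT => erase_insert (insert_mem_tilings hL hT).1)
    (fun T hT => (mul_prod_erase T w (mem_filter.1 hT).2).symm)

theorem weightedCount_eq_sum_partner (w : Finset Tri → ℚ) {R : Finset Tri} {p : Tri}
    (hp : p ∈ R) :
    weightedCount w R =
      ∑ q ∈ R with ShareEdge p q, w {p, q} * weightedCount w (R \ {p, q}) := by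
  have hpartner : ∀ q ∈ {q ∈ R | ShareEdge p q}, w {p, q} * weightedCount w (R \ {p, q}) =
      ∑ T ∈ tilings R, if {p, q} ∈ T then ∏ a ∈ T, w a else 0 := fun q hq => by
    obtain ⟨hqR, hpq⟩ := mem_filter.1 hq
    rw [← sum_tilings_containing w (pair_mem_lozenges hp hqR hpq), sum_filter]
  rw [sum_congr rfl hpartner, sum_comm, weightedCount]
  refine sum_congr rfl fun T hT => ?_
  obtain ⟨q, ⟨hqR, hpq, hqT⟩, hunique⟩ := existsUnique_partner hT hp
  rw [sum_eq_single_of_mem q (mem_filter.2 ⟨hqR, hpq⟩), if_pos hqT]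
  intro r hr hrq
  obtain ⟨hrR, hpr⟩ := mem_filter.1 hr
  exact if_neg fun hrT => hrq (hunique r ⟨hrR, hpr, hrT⟩)

theorem weightedCount_of_unique_neighbor (w : Finset Tri → ℚ) {R : Finset Tri} {p q : Tri}
    (hp : p ∈ R) (hq : q ∈ R) (hpq : ShareEdge p q) (hunique : ∀ r ∈ R, ShareEdge p r → r = q) :
    weightedCount w R = w {p, q} * weightedCount w (R \ {p, q}) := by
  have hneighbors : {r ∈ R | ShareEdge p r} = {q} := by
    ext r
    rw [mem_filter, mem_singleton]
    exact ⟨fun h => hunique r h.1 h.2, fun h => h ▸ ⟨hq, hpq⟩⟩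
  rw [weightedCount_eq_sum_partner w hp, hneighbors, sum_singleton]

/-- Processing `X` by increasing rank, each `p ∈ X` is left with `f p` as its only free
neighbour. -/
theorem weightedCount_of_forced_matching {α : Type*} [LinearOrder α] (w : Finset Tri → ℚ)
    (rank : Tri → α) (f : Tri → Tri) {R X : Finset Tri} (hX : X ⊆ R) (hfX : X.image f ⊆ R)
    (hinj : Set.InjOn f X) (hdisj : Disjoint X (X.image f)) (hadj : ∀ p ∈ X, ShareEdge p (f p))
    (hforced : ∀ p ∈ X, ∀ q ∈ R, ShareEdge p q → q ≠ f p → ∃ r ∈ X, rank r < rank p ∧ q = f r) :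
    weightedCount w R = (∏ p ∈ X, w {p, f p}) * weightedCount w (R \ (X ∪ X.image f)) := by
  induction X using Finset.induction_on_max_value rank with
  | empty => simp
  | insert p X hpX hmax ih =>
    have hsub := subset_insert p X
    have lower {r q : Tri} (hr : r ∈ insert p X) (hq : q ∈ R) (hrq : ShareEdge r q)
        (hne : q ≠ f r) : ∃ s ∈ X, rank s < rank r ∧ q = f s := by
      obtain ⟨s, hs, hlt, rfl⟩ := hforced r hr q hq hrq hne
      have hrank : rank r ≤ rank p := by
        rcases mem_insert.1 hr with rfl | hr
        exacts [le_rfl, hmax r hr]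
      exact ⟨s, mem_of_mem_insert_of_ne hs fun h => (h ▸ hlt).not_ge hrank, hlt, rfl⟩
    rw [ih (hsub.trans hX) ((image_subset_image hsub).trans hfX)
      (hinj.mono (coe_subset.2 hsub)) (hdisj.mono hsub (image_subset_image hsub))
      (fun r hr => hadj r (hsub hr)) fun r hr q => lower (hsub hr),
      weightedCount_of_unique_neighbor w (p := p) (q := f p)]
    · rw [prod_insert hpX, sdiff_sdiff, image_insert, ← mul_assoc, mul_comm (w _)]
      congr 3
      grind
    · have : p ∉ X.image f := fun h =>
        disjoint_left.1 hdisj (mem_insert_self p X) (image_subset_image hsub h)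
      exact mem_sdiff.2 ⟨hX (mem_insert_self p X), by simp [hpX, this]⟩
    · have hfpX : f p ∉ X := fun h =>
        disjoint_left.1 hdisj (hsub h) (mem_image_of_mem f (mem_insert_self p X))
      have hfp : f p ∉ X.image f := fun h => by
        obtain ⟨r, hr, heq⟩ := mem_image.1 h
        exact hpX (hinj (mem_insert_of_mem hr) (mem_insert_self p X) heq ▸ hr)
      exact mem_sdiff.2 ⟨hfX (mem_image_of_mem f (mem_insert_self p X)), by simp [hfpX, hfp]⟩
    · exact hadj p (mem_insert_self p X)
    · intro q hq hpq
      by_contra hne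
      obtain ⟨s, hs, -, rfl⟩ := lower (mem_insert_self p X) (mem_sdiff.1 hq).1 hpq hne
      exact (mem_sdiff.1 hq).2 (mem_union_right _ (mem_image_of_mem f hs))

/-! ### Filling a row of a trapezoid -/

/-- `W` behaves like a weighted tiling count on finite sets of cells. A cell `(c, y)` stands for a
unit triangle of row `y` whose centre has horizontal position `c / 2`; it points up if `c - y` is
odd and down if `c - y` is even. `v c y` is the weight of the vertical lozenge made of the cells
`(c, y)` and `(c, y + 1)`, and the other lozenges have weight `1`. Only the expansions along a
leftmost cell of the lowest row are recorded. -/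
structure IsCellCount {K : Type*} [CommSemiring K] (W : Finset (ℤ × ℤ) → K) (v : ℤ → ℤ → K) :
    Prop where
  empty : W ∅ = 1
  up : ∀ (R : Finset (ℤ × ℤ)) (c y : ℤ), (c, y) ∈ R → Odd (c - y) → (c - 1, y) ∉ R →
    (c, y - 1) ∉ R → W R = if (c + 1, y) ∈ R then W (R \ {(c, y), (c + 1, y)}) else 0
  down : ∀ (R : Finset (ℤ × ℤ)) (c y : ℤ), (c, y) ∈ R → Even (c - y) → (c - 1, y) ∉ R →
    W R = (if (c + 1, y) ∈ R then W (R \ {(c, y), (c + 1, y)}) else 0) +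
      (if (c, y + 1) ∈ R then v c y * W (R \ {(c, y), (c, y + 1)}) else 0)

/-- The cells left over in the middle of a sweep through row `y`: the cells in the rows from `y` to
`m - 1` of a trapezoid with western side `c = 0` and southern side of length `N`, except those of
row `y` that are left of `c` or in `A`, and those of row `y + 1` in `U`. -/
noncomputable def sweptRegion (N m y c : ℤ) (A U : Finset ℤ) : Finset (ℤ × ℤ) :=
  {p ∈ Icc 0 (2 * N - y) ×ˢ Ico y m |
    p.1 < 2 * N - p.2 ∧ (p.2 = y → c ≤ p.1 ∧ p.1 ∉ A) ∧ (p.2 = y + 1 → p.1 ∉ U)}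

/-- The cells of the trapezoid in the rows from `y` to `m - 1`, where row `y` has dents at `A`. -/
noncomputable def dentedRegion (N m y : ℤ) (A : Finset ℤ) : Finset (ℤ × ℤ) :=
  sweptRegion N m y 0 A ∅

section SweptRegion

variable {N m y c d : ℤ} {A U : Finset ℤ}

theorem mem_sweptRegion {p : ℤ × ℤ} :
    p ∈ sweptRegion N m y c A U ↔ 0 ≤ p.1 ∧ y ≤ p.2 ∧ p.2 < m ∧ p.1 < 2 * N - p.2 ∧
      (p.2 = y → c ≤ p.1 ∧ p.1 ∉ A) ∧ (p.2 = y + 1 → p.1 ∉ U) := by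
  simp only [sweptRegion, mem_filter, mem_product, mem_Icc, mem_Ico]
  grind

theorem mem_sweptRegion_row :
    (d, y) ∈ sweptRegion N m y c A U ↔ 0 ≤ d ∧ y < m ∧ d < 2 * N - y ∧ c ≤ d ∧ d ∉ A := by
  simp [mem_sweptRegion]

theorem mem_sweptRegion_row_succ :
    (d, y + 1) ∈ sweptRegion N m y c A U ↔ 0 ≤ d ∧ y + 1 < m ∧ d < 2 * N - (y + 1) ∧ d ∉ U := by
  simp [mem_sweptRegion]

theorem notMem_sweptRegion_row_pred : (d, y - 1) ∉ sweptRegion N m y c A U := by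
  simp [mem_sweptRegion]

theorem mem_dentedRegion {p : ℤ × ℤ} :
    p ∈ dentedRegion N m y A ↔
      0 ≤ p.1 ∧ y ≤ p.2 ∧ p.2 < m ∧ p.1 < 2 * N - p.2 ∧ (p.2 = y → p.1 ∉ A) := by
  simp only [dentedRegion, mem_sweptRegion, notMem_empty]
  grind

theorem sweptRegion_eq_dentedRegion (hc : 2 * N - y ≤ c) :
    sweptRegion N m y c A U = dentedRegion N m (y + 1) U := by
  ext ⟨a, b⟩
  simp only [mem_dentedRegion, mem_sweptRegion]
  grind

theorem sweptRegion_of_mem (hc : c ∈ A) :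
    sweptRegion N m y c A U = sweptRegion N m y (c + 1) A U := by
  ext ⟨a, b⟩
  simp only [mem_sweptRegion]
  grind

theorem sweptRegion_image_succ {k : ℕ} (a : Fin (k + 1) → ℤ) :
    sweptRegion N m y (a 0 + 1) (univ.image a) U =
      sweptRegion N m y (a 0 + 1) (univ.image fun i => a (Fin.succ i)) U := by
  ext ⟨b, z⟩
  simp only [mem_sweptRegion, mem_image, mem_univ, true_and, Fin.exists_fin_succ]
  grind

theorem sweptRegion_sdiff_horizontal :
    sweptRegion N m y c A U \ {(c, y), (c + 1, y)} = sweptRegion N m y (c + 2) A U := by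
  ext ⟨a, b⟩
  simp only [mem_sdiff, mem_sweptRegion, mem_insert, mem_singleton, Prod.mk.injEq]
  grind

theorem sweptRegion_sdiff_vertical :
    sweptRegion N m y c A U \ {(c, y), (c, y + 1)} =
      sweptRegion N m y (c + 1) A (insert c U) := by
  ext ⟨a, b⟩
  simp only [mem_sdiff, mem_sweptRegion, mem_insert, mem_singleton, Prod.mk.injEq]
  grind

end SweptRegion

namespace IsCellCount

variable {K : Type*} [CommSemiring K] {W : Finset (ℤ × ℤ) → K} {v : ℤ → ℤ → K}
  {N m y a c : ℤ} {A U : Finset ℤ}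

theorem up_step (hW : IsCellCount W v) (hy : y < m) (hc : 0 ≤ c) (hcN : c < 2 * N - y)
    (hcA : c ∉ A) (hodd : Odd (c - y)) :
    W (sweptRegion N m y c A U) =
      if c + 1 < 2 * N - y ∧ c + 1 ∉ A then W (sweptRegion N m y (c + 2) A U) else 0 := by
  rw [hW.up _ c y (mem_sweptRegion_row.2 ⟨hc, hy, hcN, le_rfl, hcA⟩) hodd
    (by rw [mem_sweptRegion_row]; omega) notMem_sweptRegion_row_pred,
    sweptRegion_sdiff_horizontal]
  refine if_congr ?_ rfl rfl
  rw [mem_sweptRegion_row]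
  grind

theorem down_step (hW : IsCellCount W v) (hy : y < m) (hc : 0 ≤ c) (hcN : c < 2 * N - y)
    (hcA : c ∉ A) (heven : Even (c - y)) :
    W (sweptRegion N m y c A U) =
      (if c + 1 < 2 * N - y ∧ c + 1 ∉ A then W (sweptRegion N m y (c + 2) A U) else 0) +
      (if y + 1 < m ∧ c + 1 < 2 * N - y ∧ c ∉ U then
        v c y * W (sweptRegion N m y (c + 1) A (insert c U)) else 0) := by
  rw [hW.down _ c y (mem_sweptRegion_row.2 ⟨hc, hy, hcN, le_rfl, hcA⟩) heven
    (by rw [mem_sweptRegion_row]; omega), sweptRegion_sdiff_horizontal,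
    sweptRegion_sdiff_vertical]
  refine congrArg₂ _ (if_congr ?_ rfl rfl) (if_congr ?_ rfl rfl)
  · rw [mem_sweptRegion_row]
    grind
  · rw [mem_sweptRegion_row_succ]
    grind

theorem eq_zero_of_up (hW : IsCellCount W v) (hy : y < m) (hc : 0 ≤ c) (hcN : c < 2 * N - y)
    (hodd : Odd (c - y)) (hA : ∀ d ∈ A, d < c) : W (sweptRegion N m y c A U) = 0 := by
  obtain ⟨n, hn⟩ : ∃ n : ℕ, 2 * N - y = c + 2 * n + 1 :=
    ⟨(2 * N - y - c).toNat / 2, by grind⟩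
  induction n generalizing c with
  | zero => rw [hW.up_step hy hc hcN (fun h => (hA c h).false) hodd, if_neg (by omega)]
  | succ n ih =>
    rw [hW.up_step hy hc hcN (fun h => (hA c h).false) hodd,
      if_pos ⟨by omega, fun h => by grind⟩]
    exact ih (by omega) (by omega) (by grind) (fun d hd => by grind) (by grind)

theorem eq_dentedRegion_of_down (hW : IsCellCount W v) (hy : y < m) (hc : 0 ≤ c)
    (hcN : c ≤ 2 * N - y) (heven : Even (c - y)) (hA : ∀ d ∈ A, d < c) :
    W (sweptRegion N m y c A U) = W (dentedRegion N m (y + 1) U) := by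
  obtain ⟨n, hn⟩ : ∃ n : ℕ, 2 * N - y = c + 2 * n := ⟨(2 * N - y - c).toNat / 2, by grind⟩
  induction n generalizing c with
  | zero => rw [sweptRegion_eq_dentedRegion (by omega)]
  | succ n ih =>
    rw [hW.down_step hy hc (by omega) (fun h => (hA c h).false) heven,
      if_pos ⟨by omega, fun h => by grind⟩,
      hW.eq_zero_of_up (c := c + 1) (A := A) hy (by omega) (by omega) (by grind)
        fun d hd => by linarith [hA d hd], mul_zero,
      ite_self, add_zero]
    exact ih (by omega) (by omega) (by grind) (fun d hd => by grind) (by grind)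

theorem up_to_dent (hW : IsCellCount W v) (hy : y < m) (hc : 0 ≤ c) (hca : c ≤ a)
    (haN : a < 2 * N - y) (hcy : Odd (c - y)) (hay : Odd (a - y)) (haA : a ∈ A)
    (hA : ∀ d ∈ A, c ≤ d → a ≤ d) :
    W (sweptRegion N m y c A U) = W (sweptRegion N m y (a + 1) A U) := by
  obtain ⟨n, hn⟩ : ∃ n : ℕ, a = c + 2 * n := ⟨(a - c).toNat / 2, by grind⟩
  induction n generalizing c with
  | zero =>
    obtain rfl : a = c := by simpa using hn
    rw [sweptRegion_of_mem haA]
  | succ n ih =>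
    rw [hW.up_step hy hc (by omega) (by grind) hcy, if_pos ⟨by omega, by grind⟩]
    exact ih (by omega) (by omega) (by grind) (by grind) (by grind)

end IsCellCount

/-- The integers `b` with `c ≤ b < a` and `b - c` even. -/
noncomputable def evenSteps (c a : ℤ) : Finset ℤ := {b ∈ Ico c a | Even (b - c)}

theorem mem_evenSteps {c a b : ℤ} : b ∈ evenSteps c a ↔ c ≤ b ∧ b < a ∧ Even (b - c) := by
  simp [evenSteps, and_assoc]

theorem evenSteps_eq_insert {c a : ℤ} (h : c < a) :
    evenSteps c a = insert c (evenSteps (c + 2) a) := by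
  ext b
  simp only [mem_insert, mem_evenSteps, Int.even_iff]
  omega

theorem notMem_evenSteps_add_two {c a : ℤ} : c ∉ evenSteps (c + 2) a := by
  simp [mem_evenSteps]

theorem evenSteps_of_le {c a : ℤ} (h : a ≤ c) : evenSteps c a = ∅ := by
  simp [evenSteps, Ico_eq_empty_of_le h]

theorem IsCellCount.down_to_dent {K : Type*} [CommSemiring K] {W : Finset (ℤ × ℤ) → K}
    {v : ℤ → ℤ → K} (hW : IsCellCount W v) {N m y a c : ℤ} {A U : Finset ℤ} (hy : y + 1 < m)
    (hc : 0 ≤ c) (hca : c ≤ a) (haN : a < 2 * N - y) (hcy : Even (c - y)) (hay : Odd (a - y))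
    (haA : a ∈ A) (hA : ∀ d ∈ A, c ≤ d → a ≤ d) (hU : ∀ d ∈ U, d < c) :
    W (sweptRegion N m y c A U) =
      ∑ b ∈ evenSteps c a, v b y * W (sweptRegion N m y (a + 1) A (insert b U)) := by
  obtain ⟨n, hn⟩ : ∃ n : ℕ, a = c + 2 * n + 1 := ⟨(a - c).toNat / 2, by grind⟩
  induction n generalizing c with
  | zero =>
    rw [hW.down_step (by omega) hc (by omega) (by grind) hcy,
      if_neg (fun h => h.2 (by convert haA; omega)), if_pos ⟨hy, by omega, by grind⟩,
      hW.up_to_dent (c := c + 1) (by omega) (by omega) (by omega) haN (by grind) hay haA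
        fun d hd hcd => hA d hd (by omega),
      evenSteps_eq_insert (by omega), evenSteps_of_le (by omega), insert_empty_eq, sum_singleton,
      zero_add]
  | succ n ih =>
    rw [hW.down_step (by omega) hc (by omega) (by grind) hcy,
      if_pos ⟨by omega, by grind⟩, if_pos ⟨hy, by omega, by grind⟩,
      hW.up_to_dent (c := c + 1) (by omega) (by omega) (by omega) haN (by grind) hay haA
        fun d hd hcd => hA d hd (by omega),
      evenSteps_eq_insert (by omega), sum_insert notMem_evenSteps_add_two, add_comm]
    congr 1
    exact ih (by omega) (by omega) (by grind) (by grind) (by grind) (by grind)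

/-- The positions of the vertical lozenge between the dents `a (i - 1)` and `a i`, where `c` is the
first free position left of `a 0`. -/
noncomputable def gap {k : ℕ} (c : ℤ) (a : Fin k → ℤ) (i : Fin k) : Finset ℤ :=
  evenSteps ((Fin.cons c fun j => a j + 1 : Fin (k + 1) → ℤ) i.castSucc) (a i)

theorem gap_zero {k : ℕ} (c : ℤ) (a : Fin (k + 1) → ℤ) : gap c a 0 = evenSteps c (a 0) := rfl

theorem gap_succ {k : ℕ} (c : ℤ) (a : Fin (k + 1) → ℤ) (i : Fin k) :
    gap c a i.succ = evenSteps (a i.castSucc + 1) (a i.succ) := by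
  rw [gap, ← Fin.succ_castSucc, Fin.cons_succ]

theorem gap_tail {k : ℕ} (a : Fin (k + 1) → ℤ) (i : Fin k) :
    gap (a 0 + 1) (fun j => a j.succ) i = evenSteps (a i.castSucc + 1) (a i.succ) := by
  cases k with
  | zero => exact i.elim0
  | succ k =>
    refine Fin.cases rfl (fun j => ?_) i
    rw [gap_succ, Fin.succ_castSucc]

theorem sum_piFinset_gap {M : Type*} [AddCommMonoid M] {k : ℕ} (c : ℤ) (a : Fin (k + 1) → ℤ)
    (f : (Fin (k + 1) → ℤ) → M) :
    ∑ b ∈ Fintype.piFinset (gap c a), f b =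
      ∑ b₀ ∈ evenSteps c (a 0), ∑ b ∈ Fintype.piFinset (gap (a 0 + 1) fun j => a j.succ),
        f (Fin.cons b₀ b) := by
  rw [← sum_product']
  refine sum_bij' (fun b _ => (b 0, fun j => b j.succ)) (fun p _ => Fin.cons p.1 p.2)
    ?_ ?_ (fun b _ => Fin.cons_self_tail b) (fun p _ => rfl)
    (fun b _ => congrArg f (Fin.cons_self_tail b).symm)
  all_goals
    simp only [mem_product, Fintype.mem_piFinset, gap_tail, Fin.forall_fin_succ, Fin.cons_zero,
      Fin.cons_succ, gap_zero, gap_succ]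
  · exact fun b hb => hb
  · exact fun p hp => hp

theorem strictMono_of_mem_gap {k : ℕ} {c : ℤ} {a b : Fin k → ℤ}
    (hb : ∀ i, b i ∈ gap c a i) : StrictMono b := by
  cases k with
  | zero => exact fun i => i.elim0
  | succ k =>
    refine Fin.strictMono_iff_lt_succ.2 fun i => ?_
    have hlt : b i.castSucc < a i.castSucc := (mem_evenSteps.1 (hb i.castSucc)).2.1
    have hle := (mem_evenSteps.1 (gap_succ c a i ▸ hb i.succ)).1
    omega

theorem mem_gap_bounds {k : ℕ} {c : ℤ} {a : Fin k → ℤ} (hca : ∀ i, c ≤ a i)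
    (hac : ∀ i, Odd (a i - c)) {i : Fin k} {x : ℤ} (hx : x ∈ gap c a i) :
    c ≤ x ∧ x < a i ∧ Even (x - c) := by
  cases k with
  | zero => exact i.elim0
  | succ k =>
    cases i using Fin.cases with
    | zero => exact mem_evenSteps.1 hx
    | succ i =>
      rw [gap_succ, mem_evenSteps] at hx
      have := hca i.castSucc
      have := hac i.castSucc
      grind

/-- Row `y` is filled from the left: exactly one vertical lozenge leads to row `y + 1` from the gap
before each dent, and none from behind the last dent. -/
theorem IsCellCount.row_transfer {K : Type*} [CommSemiring K] {W : Finset (ℤ × ℤ) → K}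
    {v : ℤ → ℤ → K} (hW : IsCellCount W v) {N m y c : ℤ} {U : Finset ℤ} {k : ℕ} {a : Fin k → ℤ}
    (hy : y < m) (hky : 0 < k → y + 1 < m) (hc : 0 ≤ c) (hcN : c ≤ 2 * N - y)
    (hcy : Even (c - y)) (hmono : StrictMono a) (hca : ∀ i, c ≤ a i)
    (haN : ∀ i, a i < 2 * N - y) (hay : ∀ i, Odd (a i - y)) (hU : ∀ d ∈ U, d < c) :
    W (sweptRegion N m y c (univ.image a) U) = ∑ b ∈ Fintype.piFinset (gap c a),
      (∏ i, v (b i) y) * W (dentedRegion N m (y + 1) (U ∪ univ.image b)) := by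
  induction k generalizing c U with
  | zero =>
    rw [hW.eq_dentedRegion_of_down hy hc hcN hcy (by simp)]
    simp
  | succ k ih =>
    have hlt : ∀ i : Fin k, a 0 < a i.succ := fun i => hmono (Fin.succ_pos i)
    have hmin : ∀ d ∈ univ.image a, c ≤ d → a 0 ≤ d := by
      simpa using fun i _ => hmono.monotone (Fin.zero_le i)
    rw [hW.down_to_dent (hky (by omega)) hc (hca 0) (haN 0) hcy (hay 0)
      (mem_image_of_mem a (mem_univ 0)) hmin hU, sum_piFinset_gap]
    refine sum_congr rfl fun b₀ hb₀ => ?_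
    have hb₀' := mem_evenSteps.1 hb₀
    rw [sweptRegion_image_succ, ih (fun _ => hky (by omega)) (by linarith [hca 0])
      (by linarith [haN 0]) (by grind) (fun i j hij => hmono (Fin.succ_lt_succ_iff.2 hij))
      (fun i => hlt i) (fun i => haN _) (fun i => hay _) (by grind), mul_sum]
    refine sum_congr rfl fun b _ => ?_
    have himage : insert b₀ U ∪ univ.image b =
        U ∪ univ.image (Fin.cons b₀ b : Fin (k + 1) → ℤ) := by
      ext d
      simp [Fin.exists_fin_succ, eq_comm, or_left_comm]
    rw [himage, Fin.prod_univ_succ, Fin.cons_zero, mul_assoc]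
    rfl

/-! ### Central factorials -/

section CentralFactorials

variable {K : Type*} [Field K]

/-- The central factorial `x ^ [2n] = x ∏ i, (x + n - i)`, `1 ≤ i ≤ 2n - 1`, over `(2n)!`. -/
def centralEven (n : ℕ) (x : K) : K :=
  (∏ i ∈ range n, (x ^ 2 - (i : K) ^ 2)) / ((2 * n).factorial : K)

/-- The central factorial `x ^ [2n + 1] = x ∏ i, (x + n + 1/2 - i)`, `1 ≤ i ≤ 2n`, over
`(2n + 1)!`. -/
def centralOdd (n : ℕ) (x : K) : K :=
  x * (∏ i ∈ range n, (x ^ 2 - (i + 1 / 2 : K) ^ 2)) / ((2 * n + 1).factorial : K)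

theorem centralEven_zero (x : K) : centralEven 0 x = 1 := by simp [centralEven]

theorem centralOdd_neg (n : ℕ) (x : K) : centralOdd n (-x) = -centralOdd n x := by
  simp [centralOdd, neg_div]

theorem centralOdd_apply_zero (n : ℕ) : centralOdd n (0 : K) = 0 := by simp [centralOdd]

variable [CharZero K]

theorem prod_sq_add_half_sub_sq (n : ℕ) (x : K) :
    ∏ i ∈ range (n + 1), ((x + 1 / 2) ^ 2 - (i : K) ^ 2) =
      (x + 1 / 2) * (x + (n + 1 / 2)) * ∏ i ∈ range n, (x ^ 2 - (i + 1 / 2 : K) ^ 2) := by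
  induction n with
  | zero => simp; ring
  | succ n ih =>
    rw [prod_range_succ, ih, prod_range_succ]
    push_cast
    ring

theorem prod_sq_add_half_sub_sq_half (n : ℕ) (x : K) :
    ∏ i ∈ range (n + 1), ((x + 1 / 2) ^ 2 - (i + 1 / 2 : K) ^ 2) =
      x * (x + (n + 1)) * ∏ i ∈ range n, (x ^ 2 - (i + 1 : K) ^ 2) := by
  induction n with
  | zero => simp; ring
  | succ n ih =>
    rw [prod_range_succ, ih, prod_range_succ]
    push_cast
    ring

theorem centralEven_succ_sub (n : ℕ) (x : K) :
    centralEven (n + 1) (x + 1 / 2) - centralEven (n + 1) (x - 1 / 2) = centralOdd n x := by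
  have hfac : ((2 * n + 1).factorial : K) ≠ 0 := Nat.cast_ne_zero.2 (Nat.factorial_ne_zero _)
  have hn : ((2 * n + 1 + 1 : ℕ) : K) ≠ 0 := Nat.cast_ne_zero.2 (Nat.succ_ne_zero _)
  have hneg : (x - 1 / 2) ^ 2 = (-x + 1 / 2) ^ 2 := by ring
  simp only [centralEven, centralOdd, hneg]
  rw [prod_sq_add_half_sub_sq, prod_sq_add_half_sub_sq, neg_sq,
    show 2 * (n + 1) = 2 * n + 1 + 1 by ring, Nat.factorial_succ (2 * n + 1), Nat.cast_mul]
  field_simp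
  push_cast
  ring

theorem centralOdd_sub (n : ℕ) (x : K) :
    centralOdd n (x + 1 / 2) - centralOdd n (x - 1 / 2) = centralEven n x := by
  have hfac : ((2 * n).factorial : K) ≠ 0 := Nat.cast_ne_zero.2 (Nat.factorial_ne_zero _)
  have hn : ((2 * n + 1 : ℕ) : K) ≠ 0 := Nat.cast_ne_zero.2 (Nat.succ_ne_zero _)
  have hneg : (x - 1 / 2) ^ 2 = (-x + 1 / 2) ^ 2 := by ring
  simp only [centralEven, centralOdd, hneg, Nat.factorial_succ (2 * n), Nat.cast_mul]
  cases n with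
  | zero => simp; ring
  | succ n =>
    rw [prod_sq_add_half_sub_sq_half, prod_sq_add_half_sub_sq_half, prod_range_succ', neg_sq]
    field_simp
    push_cast
    ring

end CentralFactorials

section Determinants

variable {R : Type*} [CommRing R]

theorem det_prod_range_sub {k : ℕ} (x : Fin k → R) (c : ℕ → R) :
    (Matrix.of fun i j : Fin k => ∏ m ∈ range j, (x i - c m)).det =
      ∏ i, ∏ j ∈ Ioi i, (x j - x i) := by
  nontriviality R
  rw [← Matrix.det_vandermonde, Matrix.det_eval_matrixOfPolynomials_eq_det_vandermonde x
    (fun j => Lagrange.nodal (range j) c) (fun j => by simp)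
    fun j => Lagrange.nodal_monic]
  simp only [Lagrange.eval_nodal]

theorem sum_piFinset_det {ι α : Type*} [DecidableEq ι] [Fintype ι] (A : ι → Finset α)
    (g : α → ι → R) :
    ∑ b ∈ Fintype.piFinset A, (Matrix.of fun i j => g (b i) j).det =
      (Matrix.of fun i j => ∑ x ∈ A i, g x j).det := by
  have hrows : (Matrix.of fun i j => ∑ x ∈ A i, g x j) = fun i => ∑ x ∈ A i, g x := by
    ext i j
    simp
  rw [hrows]
  exact ((Matrix.detRowAlternating (R := R) (n := ι)).toMultilinearMap.map_sum_finset
    (fun _ x => g x) A).symm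

theorem det_sub_pred {k : ℕ} (B : Matrix (Fin (k + 1)) (Fin (k + 1)) R) :
    (Matrix.of (Fin.cons (B 0) fun i => B i.succ - B i.castSucc)).det = B.det :=
  (Matrix.det_eq_of_forall_row_eq_smul_add_pred (fun _ => 1) (by simp) (by simp)).symm

theorem det_eq_det_sub_of_col_zero_eq_one {k : ℕ} {B : Matrix (Fin (k + 1)) (Fin (k + 1)) R}
    (hB : ∀ i, B i 0 = 1) :
    B.det = (Matrix.of fun i j : Fin k => B i.succ j.succ - B i.castSucc j.succ).det := by
  rw [← det_sub_pred, Matrix.det_succ_column_zero, Fin.sum_univ_succ, sum_eq_zero, add_zero]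
  · simp only [Fin.val_zero, pow_zero, one_mul, Matrix.of_apply, Fin.cons_zero, hB]
    congr 1
  · intro i _
    simp [hB]

end Determinants

section CentralDeterminants

variable {K : Type*} [Field K]

theorem det_centralEven {k : ℕ} (x : Fin k → K) :
    (Matrix.of fun i j : Fin k => centralEven j (x i)).det =
      (∏ i, ∏ j ∈ Ioi i, (x j ^ 2 - x i ^ 2)) / ∏ j ∈ range k, ((2 * j).factorial : K) := by
  rw [← det_prod_range_sub (fun i => x i ^ 2) (fun m => (m : K) ^ 2), div_eq_inv_mul,
    ← prod_inv_distrib, ← Fin.prod_univ_eq_prod_range, ← Matrix.det_mul_row]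
  simp only [centralEven, div_eq_inv_mul, Matrix.of_apply]

theorem det_centralOdd {k : ℕ} (x : Fin k → K) :
    (Matrix.of fun i j : Fin k => centralOdd j (x i)).det =
      (∏ i, x i) * (∏ i, ∏ j ∈ Ioi i, (x j ^ 2 - x i ^ 2)) /
        ∏ j ∈ range k, ((2 * j + 1).factorial : K) := by
  rw [← det_prod_range_sub (fun i => x i ^ 2) (fun m => (m + 1 / 2 : K) ^ 2),
    ← Matrix.det_mul_column, div_eq_inv_mul, ← prod_inv_distrib,
    ← Fin.prod_univ_eq_prod_range, ← Matrix.det_mul_row]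
  simp only [centralOdd, div_eq_inv_mul, Matrix.of_apply]

end CentralDeterminants

section TelescopingSums

variable {c a : ℤ}

theorem sum_evenSteps_sub {M : Type*} [AddCommGroup M] (hca : c ≤ a + 1) (hodd : Odd (a - c))
    (f : ℤ → M) : ∑ b ∈ evenSteps c a, (f (b + 1) - f (b - 1)) = f a - f (c - 1) := by
  obtain ⟨n, hn⟩ : ∃ n : ℕ, a + 1 = c + 2 * n := ⟨(a + 1 - c).toNat / 2, by grind⟩
  induction n generalizing c with
  | zero =>
    obtain rfl : a = c - 1 := by grind
    simp [evenSteps_of_le]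
  | succ n ih =>
    rw [evenSteps_eq_insert (by omega), sum_insert notMem_evenSteps_add_two,
      ih (by omega) (by grind) (by grind), show c + 2 - 1 = c + 1 by ring]
    abel

theorem sum_evenSteps_add_sum_evenSteps {M : Type*} [AddCommMonoid M] {d : ℤ} (hcd : c < d)
    (hda : d < a) (hodd : Odd (d - c)) (f : ℤ → M) :
    ∑ b ∈ evenSteps c d, f b + ∑ b ∈ evenSteps (d + 1) a, f b = ∑ b ∈ evenSteps c a, f b := by
  rw [← sum_union]
  · congr 1
    ext b
    simp only [mem_union, mem_evenSteps]
    grind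
  · rw [disjoint_left]
    simp only [mem_evenSteps]
    omega

variable {K : Type*} [Field K] [CharZero K]

theorem sum_evenSteps_centralEven (hca : c ≤ a + 1) (hodd : Odd (a - c)) (j : ℕ) (σ : K) :
    ∑ b ∈ evenSteps c a, centralEven j ((b + σ) / 2) =
      centralOdd j ((a + σ) / 2) - centralOdd j (((c - 1 : ℤ) + σ) / 2) := by
  rw [← sum_evenSteps_sub hca hodd fun b => centralOdd j ((b + σ) / 2)]
  refine sum_congr rfl fun b _ => ?_
  rw [← centralOdd_sub]
  push_cast
  ring_nf

theorem sum_evenSteps_centralOdd (hca : c ≤ a + 1) (hodd : Odd (a - c)) (j : ℕ) (σ : K) :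
    ∑ b ∈ evenSteps c a, centralOdd j ((b + σ) / 2) =
      centralEven (j + 1) ((a + σ) / 2) - centralEven (j + 1) (((c - 1 : ℤ) + σ) / 2) := by
  rw [← sum_evenSteps_sub hca hodd fun b => centralEven (j + 1) ((b + σ) / 2)]
  refine sum_congr rfl fun b _ => ?_
  rw [← centralEven_succ_sub]
  push_cast
  ring_nf

end TelescopingSums

/-! ### Dented trapezoids as determinants -/

section ClosedForms

variable {K : Type*} [CommRing K] {W : Finset (ℤ × ℤ) → K} {v : ℤ → ℤ → K} {N m y c : ℤ}
  {k : ℕ} {f g : ℤ → ℕ → K}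

/-- `W` is a `k × k` determinant with rows `f (a i)` on the regions whose lowest row is row `y` and
has `k` dents, at the up-pointing cells `a 0 < a 1 < ⋯`. -/
def IsDentDet (W : Finset (ℤ × ℤ) → K) (N m y : ℤ) (k : ℕ) (f : ℤ → ℕ → K) : Prop :=
  ∀ a : Fin k → ℤ, StrictMono a → (∀ i, 0 ≤ a i) → (∀ i, a i < 2 * N - y) →
    (∀ i, Odd (a i - y)) →
      W (dentedRegion N m y (univ.image a)) = (Matrix.of fun i j : Fin k => f (a i) j).det

theorem isDentDet_zero (hW : IsCellCount W v) : IsDentDet W N m m 0 f := by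
  intro a _ _ _ _
  have hempty : dentedRegion N m m (univ.image a) = ∅ :=
    eq_empty_of_forall_notMem fun p hp => by
      have := mem_dentedRegion.1 hp
      omega
  rw [hempty, hW.empty, Matrix.det_isEmpty]

theorem IsDentDet.sweptRegion_eq_det (hg : IsDentDet W N m (y + 1) k g) (hW : IsCellCount W v)
    (hy : y < m) (hky : 0 < k → y + 1 < m) (hc : 0 ≤ c) (hcN : c ≤ 2 * N - y)
    (hcy : Even (c - y)) {a : Fin k → ℤ} (hmono : StrictMono a) (hca : ∀ i, c ≤ a i)
    (haN : ∀ i, a i < 2 * N - y) (hay : ∀ i, Odd (a i - y)) :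
    W (sweptRegion N m y c (univ.image a) ∅) =
      (Matrix.of fun i j : Fin k => ∑ x ∈ gap c a i, v x y * g x j).det := by
  rw [hW.row_transfer hy hky hc hcN hcy hmono hca haN hay (by simp),
    ← sum_piFinset_det _ fun x (j : Fin k) => v x y * g x j]
  refine sum_congr rfl fun b hb => ?_
  have hbounds : ∀ i, c ≤ b i ∧ b i < a i ∧ Even (b i - c) := fun i =>
    mem_gap_bounds hca (fun i => by grind) (Fintype.mem_piFinset.1 hb i)
  rw [empty_union, hg b (strictMono_of_mem_gap (Fintype.mem_piFinset.1 hb))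
    (fun i => by linarith [(hbounds i).1])
    (fun i => by linarith [(hbounds i).2.1, Int.add_one_le_iff.2 (haN i)])
    fun i => by grind]
  exact (Matrix.det_mul_column (fun i => v (b i) y) fun i j => g (b i) j).symm

theorem IsDentDet.of_even_row (hg : IsDentDet W N m (y + 1) k g) (hW : IsCellCount W v)
    (hy : Even y) (hym : y + 1 < m) (hyN : y ≤ 2 * N)
    (hf : ∀ a j, 0 < a → Odd a → ∑ x ∈ evenSteps 0 a, v x y * g x j = f a j) :
    IsDentDet W N m y k f := by
  intro a hmono ha0 haN hay
  have hodd : ∀ i, Odd (a i) := fun i => by grind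
  have hpos : ∀ i, 0 < a i := fun i => (ha0 i).lt_of_ne fun h => by grind
  rw [dentedRegion, hg.sweptRegion_eq_det hW (by omega) (fun _ => hym) le_rfl (by omega)
    (by grind) hmono ha0 haN hay]
  cases k with
  | zero => rw [Matrix.det_isEmpty, Matrix.det_isEmpty]
  | succ k =>
    rw [← det_sub_pred (Matrix.of fun i j : Fin (k + 1) => f (a i) j)]
    congr 1
    ext i j
    cases i using Fin.cases with
    | zero => exact hf (a 0) j (hpos 0) (hodd 0)
    | succ i =>
      simp only [Matrix.of_apply, gap_succ, Fin.cons_succ, Pi.sub_apply]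
      rw [eq_sub_iff_add_eq', ← hf _ j (hpos _) (hodd _), ← hf _ j (hpos _) (hodd _)]
      exact sum_evenSteps_add_sum_evenSteps (hpos _) (hmono Fin.castSucc_lt_succ)
        (by simpa using hodd _) _

theorem IsDentDet.of_odd_row (hg : IsDentDet W N m (y + 1) k g) (hW : IsCellCount W v)
    (hy : Odd y) (hym : y < m) (hkm : 0 < k → y + 1 < m) (hf₀ : ∀ a, f a 0 = 1)
    (hf : ∀ c a j, 0 ≤ c → c < a → Odd (a - (c + 1)) →
      ∑ x ∈ evenSteps (c + 1) a, v x y * g x j = f a (j + 1) - f c (j + 1)) :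
    IsDentDet W N m y (k + 1) f := by
  intro a hmono ha0 haN hay
  have hmin : ∀ d ∈ univ.image a, 0 ≤ d → a 0 ≤ d := by
    simpa using fun i _ => hmono.monotone (Fin.zero_le i)
  have hlt : ∀ i : Fin k, a 0 < a i.succ := fun i => hmono (Fin.succ_pos i)
  rw [dentedRegion, hW.up_to_dent hym le_rfl (ha0 0) (haN 0) (by grind) (hay 0)
      (mem_image_of_mem a (mem_univ 0)) hmin, sweptRegion_image_succ,
    hg.sweptRegion_eq_det hW hym hkm (by linarith [ha0 0]) (by linarith [haN 0])
      (by grind) (fun i j hij => hmono (Fin.succ_lt_succ_iff.2 hij)) hlt (fun i => haN _)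
      (fun i => hay _), det_eq_det_sub_of_col_zero_eq_one fun i => hf₀ (a i)]
  congr 1
  ext i j
  simp only [Matrix.of_apply, gap_tail, Fin.val_succ]
  exact hf _ _ j (ha0 _) (hmono Fin.castSucc_lt_succ) (by grind)

end ClosedForms

section BoundaryWeights

variable {K : Type*} [Field K] {W : Finset (ℤ × ℤ) → K} {v : ℤ → ℤ → K} {σ : K}
  {y₀ m N : ℤ}

/-- `v` assigns weight `1` to the vertical lozenges off the western side, and those on the western
side, which are in the even rows `y` with `y₀ ≤ y < m - 1`, have the weights for which the sums of
`centralEven j` in such a row, as functions of `(a + σ) / 2`, are odd. -/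
structure IsBoundaryWeight (v : ℤ → ℤ → K) (σ : K) (y₀ m : ℤ) : Prop where
  inner : ∀ c y, 0 < c → v c y = 1
  sum_evenSteps_zero : ∀ (y : ℤ) (j : ℕ) (a : ℤ), y₀ ≤ y → y + 1 < m → Even y → 0 < a → Odd a →
    ∑ b ∈ evenSteps 0 a, v b y * centralEven j ((b + σ) / 2) = centralOdd j ((a + σ) / 2)

variable [CharZero K]

theorem isBoundaryWeight_one : IsBoundaryWeight (fun _ _ => 1) (1 : K) y₀ m where
  inner _ _ _ := rfl
  sum_evenSteps_zero y j a _ _ _ ha hodd := by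
    simp only [one_mul]
    rw [sum_evenSteps_centralEven (by omega) (by simpa using hodd)]
    simp [centralOdd_apply_zero]

theorem isBoundaryWeight_half (hv : ∀ c y, 0 < c → v c y = 1)
    (hv₀ : ∀ y, y₀ ≤ y → y + 1 < m → Even y → v 0 y = 1 / 2) :
    IsBoundaryWeight v (0 : K) y₀ m where
  inner := hv
  sum_evenSteps_zero y j a hy hym heven ha hodd := by
    have hcorner : 1 / 2 * centralEven j (0 : K) = centralOdd j (1 / 2) := by
      rw [← centralOdd_sub, zero_sub, centralOdd_neg, zero_add]
      ring
    have hinner : ∀ b ∈ evenSteps 2 a, v b y * centralEven j (((b : K) + 0) / 2) =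
        centralEven j (((b : K) + 0) / 2) := fun b hb => by
      rw [hv b y (by linarith [(mem_evenSteps.1 hb).1]), one_mul]
    rw [evenSteps_eq_insert ha, sum_insert notMem_evenSteps_add_two, hv₀ y hy hym heven, zero_add,
      sum_congr rfl hinner, sum_evenSteps_centralEven (by omega) (by grind)]
    norm_num [hcorner]

theorem IsBoundaryWeight.isDentDet_succ (hv : IsBoundaryWeight v σ y₀ m) (hW : IsCellCount W v)
    {y : ℤ} {k : ℕ} (hy : Odd y) (hym : y < m) (hkm : 0 < k → y + 1 < m)
    (h : IsDentDet W N m (y + 1) k fun a j => centralOdd j ((a + σ) / 2)) :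
    IsDentDet W N m y (k + 1) fun a j => centralEven j ((a + σ) / 2) := by
  refine h.of_odd_row hW hy hym hkm (fun a => centralEven_zero _) fun c a j hc hca hodd => ?_
  rw [sum_congr rfl fun x hx => by
      rw [hv.inner x y (by linarith [(mem_evenSteps.1 hx).1]), one_mul],
    sum_evenSteps_centralOdd (by omega) hodd, add_sub_cancel_right]

theorem IsBoundaryWeight.isDentDet_centralOdd (hv : IsBoundaryWeight v σ y₀ m)
    (hW : IsCellCount W v) (hm : Even m) (hmN : m ≤ 2 * N) {k : ℕ} (hk : y₀ ≤ m - 2 * k) :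
    IsDentDet W N m (m - 2 * k) k fun a j => centralOdd j ((a + σ) / 2) := by
  induction k with
  | zero => simpa using isDentDet_zero hW
  | succ k ih =>
    push_cast at hk ⊢
    have ih := ih (by omega)
    rw [show m - 2 * (k : ℤ) = m - 2 * (k + 1) + 1 + 1 by ring] at ih
    have heven : Even (m - 2 * ((k : ℤ) + 1)) := hm.sub (even_two_mul _)
    exact (hv.isDentDet_succ hW heven.add_one (by omega) (by omega) ih).of_even_row hW heven
      (by omega) (by omega) fun a j => hv.sum_evenSteps_zero _ j a hk (by omega) heven

theorem IsBoundaryWeight.isDentDet_centralEven (hv : IsBoundaryWeight v σ y₀ m)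
    (hW : IsCellCount W v) (hm : Even m) (hmN : m ≤ 2 * N) {k : ℕ} (hk : y₀ ≤ m - 2 * k) :
    IsDentDet W N m (m - 2 * k - 1) (k + 1) fun a j => centralEven j ((a + σ) / 2) :=
  hv.isDentDet_succ hW (by grind) (by omega) (by omega)
    (by simpa using hv.isDentDet_centralOdd hW hm hmN hk)

end BoundaryWeights

/-! ### Products over unions of intervals -/

section AlternatingProducts

theorem prod_filter_lt_insert {α M : Type*} [LinearOrder α] [CommMonoid M] {X : Finset α} {b : α}
    (hb : ∀ x ∈ X, x < b) (f : α × α → M) :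
    ∏ p ∈ insert b X ×ˢ insert b X with p.1 < p.2, f p =
      (∏ p ∈ X ×ˢ X with p.1 < p.2, f p) * ∏ x ∈ X, f (x, b) := by
  have hbX : b ∉ X := fun h => lt_irrefl _ (hb b h)
  simp only [prod_filter, prod_product, prod_insert hbX, lt_irrefl, if_false, one_mul]
  rw [prod_eq_one fun x hx => if_neg (hb x hx).not_gt, one_mul, prod_mul_distrib, mul_comm]
  exact congrArg _ (prod_congr rfl fun x hx => if_pos (hb x hx))

theorem prod_Icc_two_mul {M : Type*} [CommMonoid M] (f : ℕ → M) (l : ℕ) :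
    ∏ i ∈ Icc 1 (2 * l), f i = ∏ i ∈ Icc 1 l, f (2 * i - 1) * f (2 * i) := by
  induction l with
  | zero => rfl
  | succ l ih =>
    rw [mul_add_one, prod_Icc_succ_top (by omega), prod_Icc_succ_top (by omega), ih,
      prod_Icc_succ_top (by omega), mul_assoc]
    rfl

variable {K : Type*} [Field K]

/-- The product of `r i j` over `1 ≤ i < j ≤ n` with `j - i` odd, divided by the same product
with `j - i` even. -/
def alternatingProd (r : ℕ → ℕ → K) (n : ℕ) : K :=
  (∏ p ∈ oddPairs n, r p.1 p.2) * ∏ p ∈ evenPairs n, (r p.1 p.2)⁻¹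

theorem alternatingProd_succ (r : ℕ → ℕ → K) (n : ℕ) :
    alternatingProd r (n + 1) = alternatingProd r n *
      ∏ i ∈ Icc 1 n, if Odd (n + 1 - i) then r i (n + 1) else (r i (n + 1))⁻¹ := by
  have merge (n : ℕ) : alternatingProd r n = ∏ p ∈ Icc 1 n ×ˢ Icc 1 n with p.1 < p.2,
      if Odd (p.2 - p.1) then r p.1 p.2 else (r p.1 p.2)⁻¹ := by
    simp only [alternatingProd, oddPairs, evenPairs, prod_ite, filter_filter, Nat.not_odd_iff_even]
  rw [merge, merge, ← insert_Icc_right_eq_Icc_add_one (by omega), prod_filter_lt_insert]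
  exact fun i hi => Nat.lt_succ_of_le (mem_Icc.1 hi).2

theorem alternatingProd_add_two (r : ℕ → ℕ → K) (l : ℕ) :
    alternatingProd r (2 * (l + 1)) = alternatingProd r (2 * l) *
      (r (2 * l + 1) (2 * l + 2) *
        ∏ i ∈ Icc 1 l, r (2 * i) (2 * l + 1) / r (2 * i - 1) (2 * l + 1) *
          (r (2 * i - 1) (2 * l + 2) / r (2 * i) (2 * l + 2))) := by
  rw [mul_add_one, alternatingProd_succ, alternatingProd_succ, prod_Icc_succ_top (by omega),
    prod_Icc_two_mul, prod_Icc_two_mul, mul_assoc, ← mul_assoc (∏ i ∈ _, _), ← prod_mul_distrib,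
    mul_comm (∏ i ∈ _, _), if_pos (by simp)]
  congr 2
  refine prod_congr rfl fun i hi => ?_
  obtain ⟨hi₁, hil⟩ := mem_Icc.1 hi
  have hodd (n : ℕ) : Odd n ↔ n % 2 = 1 := Nat.odd_iff
  rw [if_neg (by rw [hodd]; omega), if_pos (by rw [hodd]; omega), if_pos (by rw [hodd]; omega),
    if_neg (by rw [hodd]; omega)]
  ring

end AlternatingProducts

/-- The union of the intervals `[s (2i - 1), s (2i))` for `1 ≤ i ≤ l`; for the partial sums of
`t` these are the bases of the removed triangles. -/
def blocks (s : ℕ → ℕ) (l : ℕ) : Finset ℕ :=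
  (Icc 1 l).biUnion fun i => Ico (s (2 * i - 1)) (s (2 * i))

section Blocks

variable {s : ℕ → ℕ} {l x : ℕ}

theorem mem_blocks : x ∈ blocks s l ↔ ∃ i, 1 ≤ i ∧ i ≤ l ∧ s (2 * i - 1) ≤ x ∧ x < s (2 * i) := by
  simp [blocks, and_assoc]

theorem blocks_succ (s : ℕ → ℕ) (l : ℕ) :
    blocks s (l + 1) = blocks s l ∪ Ico (s (2 * l + 1)) (s (2 * l + 2)) := by
  rw [blocks, ← insert_Icc_right_eq_Icc_add_one (by omega), biUnion_insert, union_comm]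
  rfl

theorem lt_of_mem_blocks (hs : Monotone s) (hx : x ∈ blocks s l) : x < s (2 * l) := by
  obtain ⟨i, -, hil, -, hxi⟩ := mem_blocks.1 hx
  exact hxi.trans_le (hs (by omega))

theorem blocks_pairwiseDisjoint (hs : Monotone s) (l : ℕ) :
    (Set.Icc 1 l).PairwiseDisjoint fun i => Ico (s (2 * i - 1)) (s (2 * i)) := by
  have hlt {i j : ℕ} (h : i < j) :
      Disjoint (Ico (s (2 * i - 1)) (s (2 * i))) (Ico (s (2 * j - 1)) (s (2 * j))) :=
    Ico_disjoint_Ico_consecutive _ _ _ |>.mono_right (Ico_subset_Ico_left (hs (by omega)))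
  exact fun i _ j _ hij => hij.lt_or_gt.elim hlt fun h => (hlt h).symm

theorem prod_blocks {M : Type*} [CommMonoid M] (hs : Monotone s) (l : ℕ) (f : ℕ → M) :
    ∏ x ∈ blocks s l, f x = ∏ i ∈ Icc 1 l, ∏ x ∈ Ico (s (2 * i - 1)) (s (2 * i)), f x :=
  prod_biUnion (by simpa using blocks_pairwiseDisjoint hs l)

end Blocks

section PairProducts

variable {K : Type*} [Field K]

/-- The product of `g x` over `X` and of `(y - x) (y + x + τ)` over the pairs `x < y` in `X`.
The latter factors are differences of the squares of `x + τ / 2`, so with `g x = 1` and with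
`g x = x + τ / 2` this is, up to a constant, a determinant of central factorials. -/
def pairProd (g : ℕ → K) (τ : K) (X : Finset ℕ) : K :=
  (∏ x ∈ X, g x) * ∏ p ∈ X ×ˢ X with p.1 < p.2, ((p.2 : K) - p.1) * (p.2 + p.1 + τ)

theorem pairProd_const_mul (c : K) (g : ℕ → K) (τ : K) (X : Finset ℕ) :
    pairProd (fun x => c * g x) τ X = c ^ #X * pairProd g τ X := by
  rw [pairProd, prod_mul_distrib, prod_const, mul_assoc, ← pairProd]

theorem pairProd_insert (g : ℕ → K) (τ : K) {X : Finset ℕ} {b : ℕ} (hb : ∀ x ∈ X, x < b) :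
    pairProd g τ (insert b X) =
      pairProd g τ X * (g b * ∏ x ∈ X, ((b : K) - x) * (b + x + τ)) := by
  rw [pairProd, pairProd, prod_insert fun h => lt_irrefl _ (hb b h), prod_filter_lt_insert hb]
  ring

end PairProducts

theorem hyper_succ (n : ℕ) : hyper (n + 1) = hyper n * n.factorial :=
  prod_range_succ _ n

theorem hyper_ne_zero (n : ℕ) : hyper n ≠ 0 :=
  prod_ne_zero_iff.2 fun i _ => i.factorial_ne_zero

section IntervalEnds

variable {K : Type*} [Field K]

/-- The contribution of two interval ends `x ≤ y` of opposite kinds to the product formula. -/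
def endRatio (h : ℕ → K) (x y : ℕ) : K := (hyper (y - x) : K) / h (y + x)

/-- The product formula in terms of the ends of the intervals `[s (2i - 1), s (2i))`; the right
ends contribute factors `ψ`, the left ends factors `χ`. -/
def endsProd (h ψ χ : ℕ → K) (s : ℕ → ℕ) (l : ℕ) : K :=
  (∏ i ∈ Icc 1 l, ψ (s (2 * i)) * χ (s (2 * i - 1))) *
    alternatingProd (fun i j => endRatio h (s i) (s j)) (2 * l)

/-- The factor by which an additional interval `[a, b)` changes `endsProd`. -/
def lastFactor (h ψ χ : ℕ → K) (s : ℕ → ℕ) (l a b : ℕ) : K :=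
  ψ b * χ a * (endRatio h a b *
    ∏ i ∈ Icc 1 l, endRatio h (s (2 * i)) a / endRatio h (s (2 * i - 1)) a *
      (endRatio h (s (2 * i - 1)) b / endRatio h (s (2 * i)) b))

theorem endsProd_succ (h ψ χ : ℕ → K) (s : ℕ → ℕ) (l : ℕ) :
    endsProd h ψ χ s (l + 1) =
      endsProd h ψ χ s l * lastFactor h ψ χ s l (s (2 * l + 1)) (s (2 * l + 2)) := by
  rw [endsProd, endsProd, lastFactor, prod_Icc_succ_top (by omega), alternatingProd_add_two]
  exact mul_mul_mul_comm _ _ _ _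

/-- The functions from which `endsProd` builds `pairProd g τ`: `φ` is a shifted factorial, `h`
the corresponding hyperfactorial, and `ψ` and `χ` are the factors of the right and of the left
ends of the intervals. -/
structure IsProductData (g φ h ψ χ : ℕ → K) (τ : K) : Prop where
  φ_ne_zero : ∀ n, φ n ≠ 0
  φ_succ : ∀ n, 0 < n → φ (n + 1) = φ n * (n + τ)
  h_ne_zero : ∀ n, h n ≠ 0
  h_succ : ∀ n, h (n + 1) = h n * φ n
  ψ_succ : ∀ n, ψ (n + 1) = ψ n * (g n * φ (2 * n))
  ψ_mul_χ : ∀ n, ψ n * χ n = h (2 * n)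

namespace IsProductData

variable {g φ h ψ χ : ℕ → K} {τ : K} {s : ℕ → ℕ} {l a b : ℕ}

theorem endRatio_succ (hd : IsProductData g φ h ψ χ τ) {x y : ℕ} (hxy : x ≤ y) :
    endRatio h x (y + 1) = endRatio h x y * (((y - x).factorial : K) / φ (y + x)) := by
  rw [endRatio, endRatio, Nat.sub_add_comm hxy, hyper_succ, add_right_comm, hd.h_succ,
    Nat.cast_mul, mul_div_mul_comm]

theorem prod_Ico [CharZero K] (hd : IsProductData g φ h ψ χ τ) {c : ℕ} (hab : a ≤ b)
    (hbc : b ≤ c) :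
    ∏ x ∈ Ico a b, ((c : K) - x) * (c + x + τ) =
      (((c - a).factorial : K) / φ (c + a)) / (((c - b).factorial : K) / φ (c + b)) := by
  have hfac (n : ℕ) : (n.factorial : K) ≠ 0 := Nat.cast_ne_zero.2 n.factorial_ne_zero
  induction b, hab using Nat.le_induction with
  | base => rw [Ico_self, prod_empty, div_self (div_ne_zero (hfac _) (hd.φ_ne_zero _))]
  | succ b hab ih =>
    obtain ⟨d, rfl⟩ := Nat.exists_eq_add_of_le hbc
    have hd₁ : (d : K) + 1 ≠ 0 := Nat.cast_add_one_ne_zero d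
    have hφ := hd.φ_ne_zero
    rw [prod_Ico_succ_top hab, ih (by omega), ← add_assoc (b + 1 + d), hd.φ_succ _ (by omega),
      show b + 1 + d - b = d + 1 by omega, show b + 1 + d - (b + 1) = d by omega,
      Nat.factorial_succ]
    push_cast
    field_simp [hfac, hφ]
    ring

theorem lastFactor_self [CharZero K] (hd : IsProductData g φ h ψ χ τ) (s : ℕ → ℕ) (l a : ℕ) :
    lastFactor h ψ χ s l a a = 1 := by
  have hne (x : ℕ) : endRatio h x a ≠ 0 :=
    div_ne_zero (Nat.cast_ne_zero.2 (hyper_ne_zero _)) (hd.h_ne_zero _)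
  rw [lastFactor, hd.ψ_mul_χ, prod_eq_one, mul_one, endRatio, Nat.sub_self, ← two_mul]
  · simp [hyper, hd.h_ne_zero]
  · exact fun i _ => by rw [div_mul_div_cancel₀ (hne _), div_self (hne _)]

theorem lastFactor_succ [CharZero K] (hd : IsProductData g φ h ψ χ τ) (hs : Monotone s)
    (hla : s (2 * l) ≤ a) (hab : a ≤ b) :
    lastFactor h ψ χ s l a (b + 1) = lastFactor h ψ χ s l a b *
      (g b * ((∏ x ∈ blocks s l, ((b : K) - x) * (b + x + τ)) *
        ∏ x ∈ Ico a b, ((b : K) - x) * (b + x + τ))) := by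
  have hblock : ∀ i ∈ Icc 1 l, s (2 * i - 1) ≤ s (2 * i) ∧ s (2 * i) ≤ b := fun i hi =>
    ⟨hs (by omega), (hs (by rw [mem_Icc] at hi; omega)).trans (hla.trans hab)⟩
  have hstep : ∀ i ∈ Icc 1 l,
      endRatio h (s (2 * i - 1)) (b + 1) / endRatio h (s (2 * i)) (b + 1) =
        endRatio h (s (2 * i - 1)) b / endRatio h (s (2 * i)) b *
          ∏ x ∈ Ico (s (2 * i - 1)) (s (2 * i)), ((b : K) - x) * (b + x + τ) := fun i hi => by
    obtain ⟨hi₁, hi₂⟩ := hblock i hi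
    rw [hd.prod_Ico hi₁ hi₂, hd.endRatio_succ hi₂, hd.endRatio_succ (hi₁.trans hi₂),
      mul_div_mul_comm]
  have hlast : φ (2 * b) * ((b - a).factorial / φ (b + a)) =
      ∏ x ∈ Ico a b, ((b : K) - x) * (b + x + τ) := by
    rw [hd.prod_Ico hab le_rfl, Nat.sub_self, Nat.factorial_zero, Nat.cast_one, div_div_eq_mul_div,
      div_one, mul_comm, two_mul]
  rw [lastFactor, lastFactor, prod_congr rfl fun i hi => congrArg _ (hstep i hi),
    prod_blocks hs, hd.endRatio_succ hab, hd.ψ_succ, ← hlast]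
  simp only [prod_mul_distrib]
  ring

theorem endsProd_eq_pairProd [CharZero K] (hd : IsProductData g φ h ψ χ τ) (hs : Monotone s)
    (l : ℕ) : endsProd h ψ χ s l = pairProd g τ (blocks s l) := by
  induction l with
  | zero => simp [endsProd, alternatingProd, pairProd, blocks, oddPairs, evenPairs]
  | succ l ih =>
    rw [endsProd_succ, ih, blocks_succ]
    have hla : s (2 * l) ≤ s (2 * l + 1) := hs (by omega)
    have hab : s (2 * l + 1) ≤ s (2 * l + 2) := hs (by omega)
    generalize s (2 * l + 1) = a at *
    generalize s (2 * l + 2) = b at *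
    have hlt : ∀ x ∈ blocks s l, x < a := fun x hx => (lt_of_mem_blocks hs hx).trans_le hla
    induction b, hab using Nat.le_induction with
    | base => rw [hd.lastFactor_self, mul_one, Ico_self, union_empty]
    | succ b hab ih =>
      have hX : ∀ x ∈ blocks s l ∪ Ico a b, x < b := fun x hx =>
        (mem_union.1 hx).elim (fun hx => (hlt x hx).trans_le hab) fun hx => (mem_Ico.1 hx).2
      have hdisj : Disjoint (blocks s l) (Ico a b) := disjoint_left.2 fun x hx hx' =>
        (hlt x hx).not_ge (mem_Ico.1 hx').1
      rw [← insert_Ico_right_eq_Ico_add_one hab, union_insert, pairProd_insert _ _ hX, ← ih,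
        hd.lastFactor_succ hs hla hab, prod_union hdisj, mul_assoc]

end IsProductData

end IntervalEnds

/-! ### Forced lozenges above the removed triangles -/

section Sequences

variable {l : ℕ} (t : Fin (2 * l) → ℕ)

theorem psum_succ {k : ℕ} (h : k < 2 * l) : psum t (k + 1) = psum t k + t ⟨k, h⟩ := by
  have hinsert : (univ.filter fun j : Fin (2 * l) => j.val < k + 1) =
      insert ⟨k, h⟩ (univ.filter fun j : Fin (2 * l) => j.val < k) := by
    ext j
    simp only [mem_filter, mem_univ, true_and, mem_insert, Fin.ext_iff]
    omega
  rw [psum, hinsert, sum_insert (by simp), add_comm, psum]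

theorem psum_mono : Monotone (psum t) := fun _ _ hab =>
  sum_le_sum_of_subset (monotone_filter_right _ fun _ _ hj => lt_of_lt_of_le hj hab)

theorem psum_two_mul : psum t (2 * l) = evenSum t + oddSum t := by
  calc psum t (2 * l) = psum t (2 * l) - psum t (2 * 0) := by simp [psum]
    _ = ∑ i ∈ range l, (psum t (2 * (i + 1)) - psum t (2 * i)) :=
        (sum_range_tsub (f := fun i => psum t (2 * i))
          ((psum_mono t).comp fun _ _ h => Nat.mul_le_mul_left 2 h) l).symm
    _ = ∑ i : Fin l, (psum t (2 * (i + 1)) - psum t (2 * i)) := (Fin.sum_univ_eq_sum_range _ l).symm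
    _ = evenSum t + oddSum t := by
        rw [evenSum, oddSum, ← sum_add_distrib]
        refine sum_congr rfl fun i _ => ?_
        rw [mul_add_one, psum_succ t (by omega : 2 * i.val + 1 < 2 * l), psum_succ t (by omega)]
        omega

theorem card_blocks_psum : #(blocks (psum t) l) = evenSum t := by
  rw [blocks, card_biUnion (by simpa using blocks_pairwiseDisjoint (psum_mono t) l), evenSum,
    ← Ico_add_one_right_eq_Icc, sum_Ico_eq_sum_range, Nat.add_sub_cancel,
    ← Fin.sum_univ_eq_sum_range fun i => #(Ico (psum t (2 * (1 + i) - 1)) (psum t (2 * (1 + i))))]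
  refine sum_congr rfl fun i _ => ?_
  rw [Nat.card_Ico, mul_add, mul_one, add_comm 2, psum_succ t (by omega : 2 * i.val + 1 < 2 * l)]
  exact Nat.add_sub_cancel_left ..

end Sequences

/-- `B` is shaped like a union of up-pointing triangles standing on the horizontal line through the
origin: above the line, its up-pointing unit triangles are exactly those standing on a
down-pointing one, and both up-pointing neighbours of a down-pointing one in its row belong
to `B`. -/
structure IsTrianglePile (B : Finset Tri) : Prop where
  nonneg : ∀ {x y b}, (x, y, b) ∈ B → 0 ≤ y
  up_add_one_mem : ∀ {x y}, 0 ≤ y → ((x, y + 1, true) ∈ B ↔ (x, y, false) ∈ B)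
  up_left_mem : ∀ {x y}, (x, y, false) ∈ B → (x, y, true) ∈ B
  up_right_mem : ∀ {x y}, (x, y, false) ∈ B → (x + 1, y, true) ∈ B

/-- The up-pointing triangle that shares the top edge of a down-pointing triangle. -/
def above (p : Tri) : Tri := (p.1, p.2.1 + 1, true)

namespace IsTrianglePile

variable {B R : Finset Tri} {x y x' y' : ℤ} {b : Bool}

theorem mem_image_above (hB : IsTrianglePile B) :
    (x, y, b) ∈ {p ∈ B | p.2.2 = false}.image above ↔ b = true ∧ 0 < y ∧ (x, y, b) ∈ B := by
  simp only [mem_image, mem_filter]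
  constructor
  · rintro ⟨⟨x', y', b'⟩, ⟨hp, rfl⟩, he⟩
    obtain ⟨rfl, rfl, rfl⟩ : x' = x ∧ y' + 1 = y ∧ true = b := by
      simpa only [above, Prod.mk.injEq] using he
    exact ⟨rfl, by linarith [hB.nonneg hp], (hB.up_add_one_mem (hB.nonneg hp)).2 hp⟩
  · rintro ⟨rfl, hy, hp⟩
    refine ⟨(x, y - 1, false), ⟨(hB.up_add_one_mem (by omega)).1 ?_, rfl⟩, ?_⟩ <;> simp [above, hp]

theorem sdiff_sdiff_base (hB : IsTrianglePile B) :
    (R \ {p ∈ B | p.2 = (0, true)}) \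
      ({p ∈ B | p.2.2 = false} ∪ {p ∈ B | p.2.2 = false}.image above) = R \ B := by
  ext ⟨x, y, b⟩
  have hnonneg : (x, y, b) ∈ B → 0 ≤ y := hB.nonneg
  simp only [mem_sdiff, mem_union, hB.mem_image_above, mem_filter, Prod.mk.injEq]
  grind

theorem up_mem_of_shareEdge (hB : IsTrianglePile B) (hp : (x, y, false) ∈ B)
    (hpq : ShareEdge (x, y, false) (x', y', true)) (hne : (x', y', true) ≠ above (x, y, false)) :
    y' = y ∧ (x', y', true) ∈ B := by
  rcases shareEdge_down_up.1 hpq with ⟨rfl, rfl⟩ | ⟨rfl, rfl⟩ | ⟨rfl, rfl⟩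
  · exact ⟨rfl, hB.up_left_mem hp⟩
  · exact ⟨rfl, hB.up_right_mem hp⟩
  · exact absurd rfl hne

/-- Once the base row of `B` is gone, the down-pointing triangles of `B` are matched, row by row
from below, with the up-pointing triangles above them. -/
theorem weightedCount_sdiff_base (hB : IsTrianglePile B) (hBR : B ⊆ R) {w : Finset Tri → ℚ}
    (hw : ∀ x y, (x, y, false) ∈ B → w {(x, y, false), (x, y + 1, true)} = 1) :
    weightedCount w (R \ {p ∈ B | p.2 = (0, true)}) = weightedCount w (R \ B) := by
  rw [weightedCount_of_forced_matching w (fun p => p.2.1) above (X := {p ∈ B | p.2.2 = false}),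
    hB.sdiff_sdiff_base, prod_eq_one, one_mul]
  · rintro ⟨x, y, b⟩ hp
    obtain ⟨hp, rfl⟩ := mem_filter.1 hp
    exact hw x y hp
  · rintro ⟨x, y, b⟩ hp
    obtain ⟨hp, rfl⟩ := mem_filter.1 hp
    exact mem_sdiff.2 ⟨hBR hp, by simp⟩
  · rintro ⟨x, y, b⟩ hp
    obtain ⟨rfl, hy, hp⟩ := hB.mem_image_above.1 hp
    exact mem_sdiff.2 ⟨hBR hp, by simp [hy.ne']⟩
  · rintro ⟨x, y, b⟩ hp ⟨x', y', b'⟩ hq h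
    obtain ⟨-, rfl⟩ := mem_filter.1 hp
    obtain ⟨-, rfl⟩ := mem_filter.1 hq
    simpa [above] using h
  · rw [disjoint_left]
    rintro ⟨x, y, b⟩ hp hq
    exact Bool.false_ne_true ((mem_filter.1 hp).2.symm.trans (hB.mem_image_above.1 hq).1)
  · rintro ⟨x, y, b⟩ hp
    obtain ⟨-, rfl⟩ := mem_filter.1 hp
    simp [above, shareEdge_down_up]
  · rintro ⟨x, y, b⟩ hp ⟨x', y', _ | _⟩ hq hpq hne <;> obtain ⟨hp, rfl⟩ := mem_filter.1 hp
    · exact (not_shareEdge_of_same_orientation _ _ _ _ _ hpq).elim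
    · obtain ⟨rfl, hup⟩ := hB.up_mem_of_shareEdge hp hpq hne
      have hy : 0 < y' := (hB.nonneg hp).lt_of_ne' fun h =>
        (mem_sdiff.1 hq).2 (mem_filter.2 ⟨hup, by rw [h]⟩)
      obtain ⟨r, hr, hrq⟩ := mem_image.1 (hB.mem_image_above.2 ⟨rfl, hy, hup⟩)
      refine ⟨r, hr, ?_, hrq.symm⟩
      have : r.2.1 + 1 = y' := congrArg (fun p : Tri => p.2.1) hrq
      dsimp only
      omega

end IsTrianglePile

section RemovedTriangles

theorem inBaseTriangle_up {a k : ℕ} {x y : ℤ} :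
    InBaseTriangle a k (x, y, true) ↔ 0 ≤ y ∧ a ≤ x ∧ x + y + 1 ≤ a + k := by
  simp only [InBaseTriangle, mem_verts_up, forall_eq_or_imp, forall_eq]
  omega

theorem inBaseTriangle_down {a k : ℕ} {x y : ℤ} :
    InBaseTriangle a k (x, y, false) ↔ 0 ≤ y ∧ a ≤ x ∧ x + y + 2 ≤ a + k := by
  simp only [InBaseTriangle, mem_verts_down, forall_eq_or_imp, forall_eq]
  omega

variable {west : ℤ → ℤ} {m N : ℕ} {x y : ℤ}

theorem mem_trapezoid_up : (x, y, true) ∈ trapezoid west m N ↔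
    -(m : ℤ) ≤ x ∧ 0 ≤ y ∧ y < m ∧ x + y + 1 ≤ N ∧ west y ≤ x ∧ west (y + 1) ≤ x := by
  simp only [trapezoid, mem_filter, mem_product, mem_Icc, mem_Ico, mem_univ, and_true,
    mem_verts_up, forall_eq_or_imp, forall_eq]
  omega

theorem mem_trapezoid_down : (x, y, false) ∈ trapezoid west m N ↔
    -(m : ℤ) ≤ x ∧ 0 ≤ y ∧ y < m ∧ x + y + 2 ≤ N ∧ west y ≤ x + 1 ∧ west (y + 1) ≤ x := by
  simp only [trapezoid, mem_filter, mem_product, mem_Icc, mem_Ico, mem_univ, and_true,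
    mem_verts_down, forall_eq_or_imp, forall_eq]
  omega

variable {l : ℕ} (t : Fin (2 * l) → ℕ)

/-- The unit triangle `p` lies in one of the triangles that `removeTriangles t` removes. -/
def InRemovedTriangle (p : Tri) : Prop :=
  ∃ i : Fin l, InBaseTriangle (psum t (2 * i.val + 1)) (t ⟨2 * i.val + 1, by omega⟩) p

variable {t}

theorem inRemovedTriangle_up : InRemovedTriangle t (x, y, true) ↔
    0 ≤ y ∧ ∃ i < l, psum t (2 * i + 1) ≤ x ∧ x + y + 1 ≤ psum t (2 * i + 2) := by
  simp only [InRemovedTriangle, inBaseTriangle_up, Fin.exists_iff, exists_and_left]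
  refine and_congr_right fun _ => exists_congr fun i => ?_
  rw [← exists_and_left, ← exists_prop]
  refine exists_congr fun hi => ?_
  rw [psum_succ t (by omega : 2 * i + 1 < 2 * l), Nat.cast_add]

theorem inRemovedTriangle_down : InRemovedTriangle t (x, y, false) ↔
    0 ≤ y ∧ ∃ i < l, psum t (2 * i + 1) ≤ x ∧ x + y + 2 ≤ psum t (2 * i + 2) := by
  simp only [InRemovedTriangle, inBaseTriangle_down, Fin.exists_iff, exists_and_left]
  refine and_congr_right fun _ => exists_congr fun i => ?_
  rw [← exists_and_left, ← exists_prop]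
  refine exists_congr fun hi => ?_
  rw [psum_succ t (by omega : 2 * i + 1 < 2 * l), Nat.cast_add]

theorem inRemovedTriangle_base :
    InRemovedTriangle t (x, 0, true) ↔ ∃ n ∈ blocks (psum t) l, (n : ℤ) = x := by
  simp only [inRemovedTriangle_up, le_rfl, true_and, mem_blocks]
  constructor
  · rintro ⟨i, hi, hix, hxi⟩
    refine ⟨x.toNat, ⟨i + 1, by omega, hi, ?_, ?_⟩, by omega⟩
    · rw [show 2 * (i + 1) - 1 = 2 * i + 1 by omega]; omega
    · rw [mul_add_one]; omega
  · rintro ⟨n, ⟨i, hi, hil, hin, hni⟩, rfl⟩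
    obtain ⟨j, rfl⟩ := Nat.exists_eq_add_of_le' hi
    exact ⟨j, hil, by exact_mod_cast hin, by rw [← mul_add_one]; omega⟩

theorem psum_succ_le_psum_add_evenSum {i : ℕ} (hi : i < l) :
    psum t (2 * i + 2) ≤ psum t (2 * i + 1) + evenSum t := by
  rw [psum_succ t (by omega : 2 * i + 1 < 2 * l)]
  exact Nat.add_le_add_left (single_le_sum (f := fun i : Fin l => t ⟨2 * i.val + 1, by omega⟩)
    (fun _ _ => Nat.zero_le _) (mem_univ ⟨i, hi⟩)) _

theorem InRemovedTriangle.mem_trapezoid {p : Tri} (hp : InRemovedTriangle t p)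
    (hwest : ∀ y, 0 ≤ y → west y ≤ 0) (hm : evenSum t ≤ m) :
    p ∈ trapezoid west m (evenSum t + oddSum t) := by
  have hbound {i : ℕ} (hi : i < l) : psum t (2 * i + 2) ≤ evenSum t + oddSum t :=
    (psum_mono t (by omega)).trans_eq (psum_two_mul t)
  obtain ⟨x, y, _ | _⟩ := p
  · obtain ⟨hy, i, hi, hix, hxi⟩ := inRemovedTriangle_down.1 hp
    have := psum_succ_le_psum_add_evenSum (t := t) hi
    have := hbound hi
    have := hwest y hy
    have := hwest (y + 1) (by omega)
    rw [mem_trapezoid_down]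
    omega
  · obtain ⟨hy, i, hi, hix, hxi⟩ := inRemovedTriangle_up.1 hp
    have := psum_succ_le_psum_add_evenSum (t := t) hi
    have := hbound hi
    have := hwest y hy
    have := hwest (y + 1) (by omega)
    rw [mem_trapezoid_up]
    omega

theorem isTrianglePile_of_mem_iff {B : Finset Tri} (hB : ∀ p, p ∈ B ↔ InRemovedTriangle t p) :
    IsTrianglePile B where
  nonneg {x y b} hp := by
    cases b
    · exact (inRemovedTriangle_down.1 ((hB _).1 hp)).1
    · exact (inRemovedTriangle_up.1 ((hB _).1 hp)).1
  up_add_one_mem {x y} hy := by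
    rw [hB, hB, inRemovedTriangle_up, inRemovedTriangle_down, and_iff_right hy,
      and_iff_right (by omega), show x + (y + 1) + 1 = x + y + 2 by ring]
  up_left_mem {x y} h := by
    obtain ⟨hy, i, hi, hix, hxi⟩ := inRemovedTriangle_down.1 ((hB _).1 h)
    exact (hB _).2 (inRemovedTriangle_up.2 ⟨hy, i, hi, by omega, by omega⟩)
  up_right_mem {x y} h := by
    obtain ⟨hy, i, hi, hix, hxi⟩ := inRemovedTriangle_down.1 ((hB _).1 h)
    exact (hB _).2 (inRemovedTriangle_up.2 ⟨hy, i, hi, by omega, by omega⟩)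

theorem weightedCount_removeTriangles (t : Fin (2 * l) → ℕ) (w : Finset Tri → ℚ)
    (hwest : ∀ y, 0 ≤ y → west y ≤ 0) (hm : evenSum t ≤ m)
    (hw : ∀ x y : ℤ, 0 ≤ x → w {(x, y, false), (x, y + 1, true)} = 1) :
    weightedCount w (removeTriangles t (trapezoid west m (evenSum t + oddSum t))) =
      weightedCount w (trapezoid west m (evenSum t + oddSum t) \
        (blocks (psum t) l).image fun x : ℕ => ((x : ℤ), (0 : ℤ), true)) := by
  classical
  set T := trapezoid west m (evenSum t + oddSum t)
  set B : Finset Tri := {p ∈ T | InRemovedTriangle t p} with hBdef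
  have hB (p : Tri) : p ∈ B ↔ InRemovedTriangle t p := by
    rw [hBdef, mem_filter, and_iff_right_of_imp fun hp => hp.mem_trapezoid hwest hm]
  have hremove : removeTriangles t T = T \ B := by
    ext p
    simp only [removeTriangles, mem_filter, mem_sdiff, hB, InRemovedTriangle, not_exists]
  have hbase : ({p ∈ B | p.2 = (0, true)} : Finset Tri) =
      (blocks (psum t) l).image fun x : ℕ => ((x : ℤ), (0 : ℤ), true) := by
    ext ⟨x, z⟩
    simp only [mem_filter, mem_image, Prod.mk.injEq]
    constructor
    · rintro ⟨hp, rfl⟩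
      simpa using inRemovedTriangle_base.1 ((hB _).1 hp)
    · rintro ⟨n, hn, hnx, rfl⟩
      exact ⟨(hB _).2 (inRemovedTriangle_base.2 ⟨n, hn, hnx⟩), rfl⟩
  rw [hremove, ← hbase, (isTrianglePile_of_mem_iff hB).weightedCount_sdiff_base
    (filter_subset _ _) fun x y hp => hw x y ?_]
  obtain ⟨-, i, -, hix, -⟩ := inRemovedTriangle_down.1 ((hB _).1 hp)
  omega

end RemovedTriangles

/-! ### Cells and unit triangles -/

/-- The unit triangle in row `y - δ` whose centre has horizontal position `(c + δ) / 2`, for a cell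
`(c, y)`. With `δ = 0` for `𝒬` and `δ = 1` for `𝒦`, the region consists of cells with `c ≥ 0` and
the vertical lozenges on its western side start in even rows. -/
def cellTri (δ : ℤ) (p : ℤ × ℤ) : Tri :=
  if (p.1 - p.2) % 2 = 1 then ((p.1 - p.2 - 1) / 2 + δ, p.2 - δ, true)
  else ((p.1 - p.2 - 2) / 2 + δ, p.2 - δ, false)

section CellTri

variable {δ c y c' y' x : ℤ} {R : Finset (ℤ × ℤ)}

theorem cellTri_eq_up :
    cellTri δ (c, y) = (x, y', true) ↔ c = 2 * x + y' + 1 - δ ∧ y = y' + δ := by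
  unfold cellTri
  split_ifs with hodd <;>
    simp only [Prod.mk.injEq, reduceCtorEq, and_false, and_true, false_iff] at hodd ⊢ <;> omega

theorem cellTri_eq_down :
    cellTri δ (c, y) = (x, y', false) ↔ c = 2 * x + y' + 2 - δ ∧ y = y' + δ := by
  unfold cellTri
  split_ifs with hodd <;>
    simp only [Prod.mk.injEq, reduceCtorEq, and_false, and_true, false_iff] at hodd ⊢ <;> omega

theorem cellTri_injective (δ : ℤ) : Function.Injective (cellTri δ) := by
  rintro ⟨c, y⟩ ⟨c', y'⟩ h
  generalize hp : cellTri δ (c', y') = p at h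
  obtain ⟨x, z, _ | _⟩ := p <;> simp only [cellTri_eq_up, cellTri_eq_down] at h hp <;>
    rw [Prod.mk.injEq] <;> omega

theorem mem_image_cellTri_up :
    (x, y, true) ∈ R.image (cellTri δ) ↔ (2 * x + y + 1 - δ, y + δ) ∈ R := by
  simp [cellTri_eq_up]

theorem mem_image_cellTri_down :
    (x, y, false) ∈ R.image (cellTri δ) ↔ (2 * x + y + 2 - δ, y + δ) ∈ R := by
  simp [cellTri_eq_down]

theorem shareEdge_cellTri_of_odd (h : Odd (c - y)) :
    ShareEdge (cellTri δ (c, y)) (cellTri δ (c', y')) ↔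
      (y' = y ∧ (c' = c + 1 ∨ c' = c - 1)) ∨ (c' = c ∧ y' = y - 1) := by
  rw [Int.odd_iff] at h
  simp only [cellTri, h, if_true]
  split_ifs with h'
  · simp only [not_shareEdge_of_same_orientation, false_iff]
    omega
  · rw [shareEdge_up_down]
    omega

theorem shareEdge_cellTri_of_even (h : Even (c - y)) :
    ShareEdge (cellTri δ (c, y)) (cellTri δ (c', y')) ↔
      (y' = y ∧ (c' = c + 1 ∨ c' = c - 1)) ∨ (c' = c ∧ y' = y + 1) := by
  rw [Int.even_iff] at h
  simp only [cellTri, h, zero_ne_one, if_false]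
  split_ifs with h'
  · rw [shareEdge_down_up]
    omega
  · simp only [not_shareEdge_of_same_orientation, false_iff]
    omega

theorem weightedCount_image_cellTri (w : Finset Tri → ℚ) {p : ℤ × ℤ} (hp : p ∈ R) :
    weightedCount w (R.image (cellTri δ)) =
      ∑ q ∈ R with ShareEdge (cellTri δ p) (cellTri δ q),
        w {cellTri δ p, cellTri δ q} * weightedCount w ((R \ {p, q}).image (cellTri δ)) := by
  rw [weightedCount_eq_sum_partner w (mem_image_of_mem _ hp), filter_image,
    sum_image (cellTri_injective δ).injOn]
  refine sum_congr rfl fun q _ => ?_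
  rw [image_sdiff _ _ (cellTri_injective δ), image_insert, image_singleton]

theorem isCellCount_weightedCount (w : Finset Tri → ℚ) (δ : ℤ)
    (hw : ∀ c y, w {cellTri δ (c, y), cellTri δ (c + 1, y)} = 1) :
    IsCellCount (fun R => weightedCount w (R.image (cellTri δ)))
      (fun c y => w {cellTri δ (c, y), cellTri δ (c, y + 1)}) where
  empty := by rw [image_empty, weightedCount_empty]
  up R c y hR hodd hleft hbelow := by
    have hpartner : ({q ∈ R | ShareEdge (cellTri δ (c, y)) (cellTri δ q)} : Finset (ℤ × ℤ)) =
        {q ∈ ({(c + 1, y)} : Finset (ℤ × ℤ)) | q ∈ R} := by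
      ext ⟨c', y'⟩
      simp only [mem_filter, shareEdge_cellTri_of_odd hodd, mem_singleton, Prod.mk.injEq]
      grind
    rw [weightedCount_image_cellTri w hR, hpartner, sum_filter, sum_singleton, hw, one_mul]
  down R c y hR heven hleft := by
    have hpartner : ({q ∈ R | ShareEdge (cellTri δ (c, y)) (cellTri δ q)} : Finset (ℤ × ℤ)) =
        {q ∈ ({(c + 1, y), (c, y + 1)} : Finset (ℤ × ℤ)) | q ∈ R} := by
      ext ⟨c', y'⟩
      simp only [mem_filter, shareEdge_cellTri_of_even heven, mem_insert, mem_singleton,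
        Prod.mk.injEq]
      grind
    rw [weightedCount_image_cellTri w hR, hpartner, sum_filter, sum_pair (by simp), hw, one_mul]

end CellTri

theorem mem_image_base {X : Finset ℕ} {x y : ℤ} {b : Bool} :
    (x, y, b) ∈ X.image (fun n : ℕ => ((n : ℤ), (0 : ℤ), true)) ↔
      y = 0 ∧ b = true ∧ ∃ n ∈ X, (n : ℤ) = x := by
  simp only [mem_image, Prod.mk.injEq]
  grind

theorem trapezoid_sdiff_eq_image {west : ℤ → ℤ} {m N : ℕ} {δ : ℤ} (X : Finset ℕ)
    (hup : ∀ x y : ℤ, 0 ≤ y → y < m →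
      ((-(m : ℤ) ≤ x ∧ west y ≤ x ∧ west (y + 1) ≤ x) ↔ 0 ≤ 2 * x + y + 1 - δ))
    (hdown : ∀ x y : ℤ, 0 ≤ y → y < m →
      ((-(m : ℤ) ≤ x ∧ west y ≤ x + 1 ∧ west (y + 1) ≤ x) ↔ 0 ≤ 2 * x + y + 2 - δ)) :
    trapezoid west m N \ X.image (fun n : ℕ => ((n : ℤ), (0 : ℤ), true)) =
      (dentedRegion N (m + δ) δ (X.image fun n : ℕ => 2 * (n : ℤ) + 1 - δ)).image
        (cellTri δ) := by
  ext ⟨x, y, _ | _⟩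
  · rw [mem_sdiff, mem_image_base, mem_image_cellTri_down, mem_trapezoid_down, mem_dentedRegion]
    have hdent : y = 0 → 2 * x + y + 2 - δ ∉ X.image fun n : ℕ => 2 * (n : ℤ) + 1 - δ := by
      simp only [mem_image]
      omega
    have := hdown x y
    grind
  · have hdent : 2 * x + y + 1 - δ ∈ X.image (fun n : ℕ => 2 * (n : ℤ) + 1 - δ) ↔
        ∃ n ∈ X, 2 * (n : ℤ) = 2 * x + y := by
      rw [mem_image]
      exact exists_congr fun n => and_congr_right fun _ => by omega
    rw [mem_sdiff, mem_image_base, mem_image_cellTri_up, mem_trapezoid_up, mem_dentedRegion, hdent]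
    have := hup x y
    grind

/-! ### Counts as products over the removed base triangles -/

section OrderEmb

variable {X : Finset ℕ} {k : ℕ} (hX : #X = k)

theorem prod_orderEmbOfFin {M : Type*} [CommMonoid M] (f : ℕ → M) :
    ∏ i, f (X.orderEmbOfFin hX i) = ∏ x ∈ X, f x := by
  conv_rhs => rw [← X.map_orderEmbOfFin_univ hX, prod_map]
  rfl

theorem prod_Ioi_orderEmbOfFin {M : Type*} [CommMonoid M] (f : ℕ → ℕ → M) :
    ∏ i, ∏ j ∈ Ioi i, f (X.orderEmbOfFin hX i) (X.orderEmbOfFin hX j) =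
      ∏ p ∈ X ×ˢ X with p.1 < p.2, f p.1 p.2 := by
  rw [prod_filter, prod_product, ← prod_orderEmbOfFin hX]
  refine prod_congr rfl fun i _ => ?_
  rw [← prod_orderEmbOfFin hX, ← filter_lt_eq_Ioi, prod_filter]
  simp only [OrderEmbedding.lt_iff_lt]

theorem prod_mul_prod_sq_sub_sq {K : Type*} [Field K] [CharZero K] (g : ℕ → K) (τ : K) :
    (∏ i, g (X.orderEmbOfFin hX i)) * ∏ i, ∏ j ∈ Ioi i,
      (((X.orderEmbOfFin hX j : K) + τ / 2) ^ 2 - ((X.orderEmbOfFin hX i : K) + τ / 2) ^ 2) =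
      pairProd g τ X := by
  rw [pairProd, prod_orderEmbOfFin hX g,
    prod_Ioi_orderEmbOfFin hX fun x y => ((y : K) + τ / 2) ^ 2 - ((x : K) + τ / 2) ^ 2]
  congr 1
  exact prod_congr rfl fun p _ => by ring

theorem IsDentDet.apply_image {K : Type*} [CommRing K] {W : Finset (ℤ × ℤ) → K} {N : ℕ} {m δ : ℤ}
    {f : ℤ → ℕ → K} (h : IsDentDet W N m δ k f) (hδ : δ ≤ 1) (hN : ∀ x ∈ X, x < N) :
    W (dentedRegion N m δ (X.image fun x : ℕ => 2 * (x : ℤ) + 1 - δ)) =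
      (Matrix.of fun i j : Fin k => f (2 * (X.orderEmbOfFin hX i : ℤ) + 1 - δ) j).det := by
  have himage : (X.image fun x : ℕ => 2 * (x : ℤ) + 1 - δ) =
      univ.image fun i => 2 * (X.orderEmbOfFin hX i : ℤ) + 1 - δ := by
    conv_lhs => rw [← X.image_orderEmbOfFin_univ hX, image_image]
    rfl
  rw [himage]
  refine h _ (fun i j hij => ?_) (fun i => by omega) (fun i => ?_) fun i => by grind
  · have := (X.orderEmbOfFin hX).strictMono hij
    omega
  · have := hN _ (X.orderEmbOfFin_mem hX i)
    omega

end OrderEmb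

theorem prod_even_factorial_eq_hyperSkip (k : ℕ) :
    ∏ j ∈ range k, (2 * j).factorial = hyperSkip (2 * k) := by
  simp [hyperSkip]

theorem prod_odd_factorial_eq_hyperSkip (k : ℕ) :
    ∏ j ∈ range k, (2 * j + 1).factorial = hyperSkip (2 * k + 1) := by
  rw [hyperSkip, Nat.mul_add_mod, show (2 * k + 1) / 2 = k by omega]

section Regions

variable {l : ℕ} (t : Fin (2 * l) → ℕ) (w : Finset Tri → ℚ) {σ : ℚ}

theorem lt_of_mem_blocks_psum {x : ℕ} (hx : x ∈ blocks (psum t) l) : x < evenSum t + oddSum t :=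
  psum_two_mul t ▸ lt_of_mem_blocks (psum_mono t) hx

theorem weightedCount_regionQ
    (hinner : ∀ x y : ℤ, 0 ≤ x → w {(x, y, false), (x, y + 1, true)} = 1)
    (hhorizontal : ∀ c y, w {cellTri 0 (c, y), cellTri 0 (c + 1, y)} = 1)
    (hwest : IsBoundaryWeight (fun c y => w {cellTri 0 (c, y), cellTri 0 (c, y + 1)}) σ 0
      (2 * evenSum t : ℕ)) :
    weightedCount w (regionQ t) =
      pairProd (fun x => (x : ℚ) + (1 + σ) / 2) (1 + σ) (blocks (psum t) l) /
        hyperSkip (2 * evenSum t + 1) := by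
  have hcard := card_blocks_psum t
  have hdet := hwest.isDentDet_centralOdd (isCellCount_weightedCount w 0 hhorizontal)
    (N := (evenSum t + oddSum t : ℕ)) (k := evenSum t) (by simp) (by grind) (by simp)
  rw [show ((2 * evenSum t : ℕ) : ℤ) - 2 * evenSum t = 0 by simp] at hdet
  have hdent (n : ℕ) : (((2 * (n : ℤ) + 1 - 0 : ℤ) : ℚ) + σ) / 2 = n + (1 + σ) / 2 := by
    push_cast
    ring
  rw [regionQ, weightedCount_removeTriangles t w (by grind [westQ]) (by omega) hinner,
    trapezoid_sdiff_eq_image (δ := 0) _ (by grind [westQ]) (by grind [westQ]), add_zero,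
    hdet.apply_image hcard zero_le_one fun x => lt_of_mem_blocks_psum t, det_centralOdd]
  simp only [hdent]
  rw [prod_mul_prod_sq_sub_sq hcard fun x => (x : ℚ) + (1 + σ) / 2,
    ← prod_odd_factorial_eq_hyperSkip, Nat.cast_prod]

theorem weightedCount_regionK
    (hinner : ∀ x y : ℤ, 0 ≤ x → w {(x, y, false), (x, y + 1, true)} = 1)
    (hhorizontal : ∀ c y, w {cellTri 1 (c, y), cellTri 1 (c + 1, y)} = 1)
    (hwest : IsBoundaryWeight (fun c y => w {cellTri 1 (c, y), cellTri 1 (c, y + 1)}) σ 1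
      (2 * evenSum t : ℕ)) :
    weightedCount w (regionK t) =
      pairProd (fun _ => 1) σ (blocks (psum t) l) / hyperSkip (2 * evenSum t) := by
  have hcard := card_blocks_psum t
  rcases hE : evenSum t with _ | k
  · rw [hE, card_eq_zero] at hcard
    have hempty : regionK t = ∅ := by simp [regionK, removeTriangles, trapezoid, hE]
    simp [hempty, hcard, weightedCount_empty, hyperSkip, pairProd]
  have hdet := hwest.isDentDet_centralEven (isCellCount_weightedCount w 1 hhorizontal)
    (N := (evenSum t + oddSum t : ℕ)) (k := k) (by simp) (by grind) (by grind)
  rw [show ((2 * evenSum t : ℕ) : ℤ) - 2 * k - 1 = 1 by omega,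
    show ((2 * evenSum t : ℕ) : ℤ) = (2 * evenSum t - 1 : ℕ) + 1 by omega] at hdet
  rw [hE] at hcard
  have hdent (n : ℕ) : (((2 * (n : ℤ) + 1 - 1 : ℤ) : ℚ) + σ) / 2 = n + σ / 2 := by
    push_cast
    ring
  rw [regionK, weightedCount_removeTriangles t w (by grind [westK]) (by omega) hinner,
    trapezoid_sdiff_eq_image (δ := 1) _ (by grind [westK]) (by grind [westK]),
    hdet.apply_image hcard le_rfl fun x => lt_of_mem_blocks_psum t, det_centralEven]
  simp only [hdent]
  rw [← prod_mul_prod_sq_sub_sq hcard fun _ => (1 : ℚ), prod_const_one, one_mul,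
    ← prod_even_factorial_eq_hyperSkip, Nat.cast_prod]

end Regions

/-! ### The four weightings -/

section WestWeight

variable {west : ℤ → ℤ} {m : ℕ}

theorem westWeight_pair_eq_one {p q : Tri}
    (h : ∀ y ∈ Ioo (0 : ℤ) m, west (y - 1) = west y + 1 → west (y + 1) = west y →
      ¬ (p = (west y, y - 1, false) ∧ q = (west y, y, true)) ∧
        ¬ (p = (west y, y, true) ∧ q = (west y, y - 1, false))) :
    westWeight west m {p, q} = 1 := by
  refine if_neg ?_
  rintro ⟨y, hy, h₁, h₂, hpq⟩
  rw [← coe_inj, coe_pair, coe_pair, Set.pair_eq_pair_iff] at hpq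
  exact not_or.2 (h y hy h₁ h₂) hpq

theorem westWeight_horizontal (west : ℤ → ℤ) (m : ℕ) (δ c y : ℤ) :
    westWeight west m {cellTri δ (c, y), cellTri δ (c + 1, y)} = 1 := by
  refine westWeight_pair_eq_one fun z _ _ _ => ?_
  simp only [cellTri_eq_up, cellTri_eq_down]
  omega

theorem westWeight_inner (hwest : ∀ y, 0 ≤ y → west y ≤ 0) (x y : ℤ) (hx : 0 ≤ x) :
    westWeight west m {(x, y, false), (x, y + 1, true)} = 1 := by
  refine westWeight_pair_eq_one fun z hz h _ => ?_
  have := hwest (z - 1) (by grind)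
  grind

theorem isBoundaryWeight_westQ (m : ℕ) :
    IsBoundaryWeight (fun c y => westWeight westQ m {cellTri 0 (c, y), cellTri 0 (c, y + 1)})
      0 0 m := by
  refine isBoundaryWeight_half (fun c y hc => westWeight_pair_eq_one fun z _ h₁ _ => ?_)
    fun y hy hym heven => ?_
  · simp only [cellTri_eq_up, cellTri_eq_down]
    unfold westQ at *
    omega
  · refine if_pos ⟨y + 1, by grind, by grind [westQ], by grind [westQ], ?_⟩
    rw [(cellTri_eq_down (x := westQ (y + 1)) (y' := y)).2 (by grind [westQ]),
      (cellTri_eq_up (x := westQ (y + 1)) (y' := y + 1)).2 (by grind [westQ]),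
      add_sub_cancel_right]

theorem isBoundaryWeight_westK (m : ℕ) :
    IsBoundaryWeight
      (fun c y => westWeight westK (m - 1) {cellTri 1 (c, y), cellTri 1 (c, y + 1)}) 0 1 m := by
  refine isBoundaryWeight_half (fun c y hc => westWeight_pair_eq_one fun z _ h₁ _ => ?_)
    fun y hy hym heven => ?_
  · simp only [cellTri_eq_up, cellTri_eq_down]
    unfold westK at *
    omega
  · refine if_pos ⟨y, by grind, by grind [westK], by grind [westK], ?_⟩
    rw [(cellTri_eq_down (x := westK y) (y' := y - 1)).2 (by grind [westK]),
      (cellTri_eq_up (x := westK y) (y' := y)).2 (by grind [westK])]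

end WestWeight

section Counts

variable {l : ℕ} (t : Fin (2 * l) → ℕ)

theorem tilingsQ_eq_pairProd :
    (tilingsQ t : ℚ) =
      pairProd (fun x => (x : ℚ) + 1) 2 (blocks (psum t) l) / hyperSkip (2 * evenSum t + 1) := by
  rw [tilingsQ, card_tilings_eq_weightedCount, weightedCount_regionQ t _ (fun _ _ _ => rfl)
    (fun _ _ => rfl) isBoundaryWeight_one]
  norm_num

theorem weightedTilingsQ_eq_pairProd :
    weightedTilingsQ t = (1 / 2) ^ evenSum t *
      pairProd (fun x => 2 * (x : ℚ) + 1) 1 (blocks (psum t) l) /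
        hyperSkip (2 * evenSum t + 1) := by
  rw [weightedTilingsQ, weightedCount_regionQ t _ (westWeight_inner (by grind [westQ]))
    (westWeight_horizontal _ _ _) (isBoundaryWeight_westQ _), ← card_blocks_psum,
    ← pairProd_const_mul, add_zero]
  congr 3
  ext x
  ring

theorem tilingsK_eq_pairProd :
    (tilingsK t : ℚ) =
      pairProd (fun _ => 1) 1 (blocks (psum t) l) / hyperSkip (2 * evenSum t) := by
  rw [tilingsK, card_tilings_eq_weightedCount, weightedCount_regionK t _ (fun _ _ _ => rfl)
    (fun _ _ => rfl) isBoundaryWeight_one]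

theorem weightedTilingsK_eq_pairProd :
    weightedTilingsK t =
      pairProd (fun _ => 1) 0 (blocks (psum t) l) / hyperSkip (2 * evenSum t) := by
  rw [weightedTilingsK, weightedCount_regionK t _ (westWeight_inner (by grind [westK]))
    (westWeight_horizontal _ _ _) (isBoundaryWeight_westK _)]

end Counts

theorem hyper_eq_pred_mul (n : ℕ) : hyper n = hyper (n - 1) * (n - 1).factorial := by
  cases n with
  | zero => simp [hyper]
  | succ n => exact hyper_succ n

theorem hyperSkip_add_two (n : ℕ) : hyperSkip (n + 2) = hyperSkip n * n.factorial := by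
  rw [hyperSkip, Nat.add_div_right n two_pos, Nat.add_mod_right, prod_range_succ, ← hyperSkip,
    Nat.div_add_mod]

theorem hyperSkip_two_mul_add_one (n : ℕ) :
    hyperSkip (2 * n + 1) = hyperSkip (2 * n - 1) * (2 * n - 1).factorial := by
  cases n with
  | zero => simp [hyperSkip]
  | succ n => exact hyperSkip_add_two (2 * n + 1)

theorem hyperSkip_ne_zero (n : ℕ) : hyperSkip n ≠ 0 :=
  prod_ne_zero_iff.2 fun _ _ => Nat.factorial_ne_zero _

section ProductData

variable {K : Type*} [Field K] [CharZero K]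

theorem isProductData_tilingsQ :
    IsProductData (fun x => (x : K) + 1) (fun n => (n + 1).factorial) (fun n => hyper (n + 1))
      (fun n => n.factorial * hyperSkip (2 * n + 1))
      (fun n => 1 / n.factorial * (hyper (2 * n + 2) / hyperSkip (2 * n + 3))) 2 where
  φ_ne_zero n := Nat.cast_ne_zero.2 (n + 1).factorial_ne_zero
  φ_succ n _ := by
    rw [Nat.factorial_succ (n + 1)]
    push_cast
    ring
  h_ne_zero n := Nat.cast_ne_zero.2 (hyper_ne_zero _)
  h_succ n := by rw [hyper_succ (n + 1), Nat.cast_mul]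
  ψ_succ n := by
    rw [mul_add_one, add_right_comm, hyperSkip_add_two, Nat.factorial_succ n]
    push_cast
    ring
  ψ_mul_χ n := by
    have hfac : (n.factorial : K) ≠ 0 := Nat.cast_ne_zero.2 n.factorial_ne_zero
    have hfac' : ((2 * n + 1).factorial : K) ≠ 0 := Nat.cast_ne_zero.2 (Nat.factorial_ne_zero _)
    have hskip : (hyperSkip (2 * n + 1) : K) ≠ 0 := Nat.cast_ne_zero.2 (hyperSkip_ne_zero _)
    rw [hyperSkip_add_two (2 * n + 1), hyper_succ (2 * n + 1)]
    push_cast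
    field_simp

theorem isProductData_weightedTilingsQ :
    IsProductData (fun x => 2 * (x : K) + 1) (fun n => n.factorial) (fun n => hyper n)
      (fun n => hyperSkip (2 * n + 1)) (fun n => hyper (2 * n) / hyperSkip (2 * n + 1)) 1 where
  φ_ne_zero n := Nat.cast_ne_zero.2 n.factorial_ne_zero
  φ_succ n _ := by
    rw [Nat.factorial_succ]
    push_cast
    ring
  h_ne_zero n := Nat.cast_ne_zero.2 (hyper_ne_zero n)
  h_succ n := by rw [hyper_succ, Nat.cast_mul]
  ψ_succ n := by
    rw [mul_add_one, add_right_comm, hyperSkip_add_two, Nat.factorial_succ]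
    push_cast
    ring
  ψ_mul_χ n := mul_div_cancel₀ _ (Nat.cast_ne_zero.2 (hyperSkip_ne_zero _))

theorem isProductData_tilingsK :
    IsProductData (fun _ => (1 : K)) (fun n => n.factorial) (fun n => hyper n)
      (fun n => hyperSkip (2 * n)) (fun n => hyper (2 * n + 1) / hyperSkip (2 * n + 2)) 1 where
  φ_ne_zero n := Nat.cast_ne_zero.2 n.factorial_ne_zero
  φ_succ n _ := by
    rw [Nat.factorial_succ]
    push_cast
    ring
  h_ne_zero n := Nat.cast_ne_zero.2 (hyper_ne_zero n)
  h_succ n := by rw [hyper_succ, Nat.cast_mul]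
  ψ_succ n := by rw [mul_add_one, hyperSkip_add_two, Nat.cast_mul, one_mul]
  ψ_mul_χ n := by
    have hfac : ((2 * n).factorial : K) ≠ 0 := Nat.cast_ne_zero.2 (Nat.factorial_ne_zero _)
    have hskip : (hyperSkip (2 * n) : K) ≠ 0 := Nat.cast_ne_zero.2 (hyperSkip_ne_zero _)
    rw [hyperSkip_add_two, hyper_succ]
    push_cast
    field_simp

theorem isProductData_weightedTilingsK :
    IsProductData (fun _ => (1 : K)) (fun n => (n - 1).factorial) (fun n => hyper (n - 1))
      (fun n => hyperSkip (2 * n - 1)) (fun n => hyper (2 * n) / hyperSkip (2 * n + 1)) 0 where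
  φ_ne_zero n := Nat.cast_ne_zero.2 (n - 1).factorial_ne_zero
  φ_succ n hn := by
    rw [add_tsub_cancel_right, ← Nat.mul_factorial_pred hn.ne', Nat.cast_mul, add_zero, mul_comm]
  h_ne_zero n := Nat.cast_ne_zero.2 (hyper_ne_zero _)
  h_succ n := by rw [add_tsub_cancel_right, hyper_eq_pred_mul, Nat.cast_mul]
  ψ_succ n := by
    rw [show 2 * (n + 1) - 1 = 2 * n + 1 by omega, hyperSkip_two_mul_add_one, Nat.cast_mul,
      one_mul]
  ψ_mul_χ n := by
    have hfac : ((2 * n - 1).factorial : K) ≠ 0 := Nat.cast_ne_zero.2 (Nat.factorial_ne_zero _)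
    have hskip : (hyperSkip (2 * n - 1) : K) ≠ 0 := Nat.cast_ne_zero.2 (hyperSkip_ne_zero _)
    rw [hyperSkip_two_mul_add_one, hyper_eq_pred_mul (2 * n)]
    push_cast
    field_simp

end ProductData

end QuarteredHexagon

open QuarteredHexagon in
/-- In the formula for the weighted `𝒦'(t)` an argument `-1` of one of the two hyperfactorials
(which occurs only if `t` begins with two zeros) denotes an empty product; this is what the
truncated subtraction gives. -/
theorem mainTheorem6 (l : ℕ) (t : Fin (2 * l) → ℕ) :
    ((tilingsQ t : ℚ) =
      (∏ i ∈ Finset.Icc 1 l,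
          ((psum t (2 * i)).factorial : ℚ) / ((psum t (2 * i - 1)).factorial : ℚ)) /
        (hyperSkip (2 * evenSum t + 1) : ℚ) *
      (∏ i ∈ Finset.Icc 1 l,
          (hyperSkip (2 * psum t (2 * i) + 1) : ℚ) * (hyper (2 * psum t (2 * i - 1) + 2) : ℚ) /
            (hyperSkip (2 * psum t (2 * i - 1) + 3) : ℚ)) *
      (∏ p ∈ oddPairs (2 * l),
          (hyper (psum t p.2 - psum t p.1) : ℚ) / (hyper (psum t p.2 + psum t p.1 + 1) : ℚ)) *
      (∏ p ∈ evenPairs (2 * l),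
          (hyper (psum t p.2 + psum t p.1 + 1) : ℚ) / (hyper (psum t p.2 - psum t p.1) : ℚ))) ∧
    (weightedTilingsQ t =
      (1 / 2 : ℚ) ^ evenSum t / (hyperSkip (2 * evenSum t + 1) : ℚ) *
      (∏ i ∈ Finset.Icc 1 l,
          (hyperSkip (2 * psum t (2 * i) + 1) : ℚ) * (hyper (2 * psum t (2 * i - 1)) : ℚ) /
            (hyperSkip (2 * psum t (2 * i - 1) + 1) : ℚ)) *
      (∏ p ∈ oddPairs (2 * l),
          (hyper (psum t p.2 - psum t p.1) : ℚ) / (hyper (psum t p.2 + psum t p.1) : ℚ)) *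
      (∏ p ∈ evenPairs (2 * l),
          (hyper (psum t p.2 + psum t p.1) : ℚ) / (hyper (psum t p.2 - psum t p.1) : ℚ))) ∧
    ((tilingsK t : ℚ) =
      1 / (hyperSkip (2 * evenSum t) : ℚ) *
      (∏ i ∈ Finset.Icc 1 l,
          (hyperSkip (2 * psum t (2 * i)) : ℚ) * (hyper (2 * psum t (2 * i - 1) + 1) : ℚ) /
            (hyperSkip (2 * psum t (2 * i - 1) + 2) : ℚ)) *
      (∏ p ∈ oddPairs (2 * l),
          (hyper (psum t p.2 - psum t p.1) : ℚ) / (hyper (psum t p.2 + psum t p.1) : ℚ)) *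
      (∏ p ∈ evenPairs (2 * l),
          (hyper (psum t p.2 + psum t p.1) : ℚ) / (hyper (psum t p.2 - psum t p.1) : ℚ))) ∧
    (weightedTilingsK t =
      1 / (hyperSkip (2 * evenSum t) : ℚ) *
      (∏ i ∈ Finset.Icc 1 l,
          (hyperSkip (2 * psum t (2 * i) - 1) : ℚ) * (hyper (2 * psum t (2 * i - 1)) : ℚ) /
            (hyperSkip (2 * psum t (2 * i - 1) + 1) : ℚ)) *
      (∏ p ∈ oddPairs (2 * l),
          (hyper (psum t p.2 - psum t p.1) : ℚ) / (hyper (psum t p.2 + psum t p.1 - 1) : ℚ)) *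
      (∏ p ∈ evenPairs (2 * l),
          (hyper (psum t p.2 + psum t p.1 - 1) : ℚ) / (hyper (psum t p.2 - psum t p.1) : ℚ))) := by
  have hs := psum_mono t
  refine ⟨?_, ?_, ?_, ?_⟩
  · rw [tilingsQ_eq_pairProd, ← isProductData_tilingsQ.endsProd_eq_pairProd hs]
    simp only [endsProd, alternatingProd, endRatio, inv_div, mul_div_assoc, add_assoc,
      Finset.prod_mul_distrib, Finset.prod_div_distrib, Finset.prod_const_one]
    ring
  · rw [weightedTilingsQ_eq_pairProd, ← isProductData_weightedTilingsQ.endsProd_eq_pairProd hs]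
    simp only [endsProd, alternatingProd, endRatio, inv_div, mul_div_assoc]
    ring
  · rw [tilingsK_eq_pairProd, ← isProductData_tilingsK.endsProd_eq_pairProd hs]
    simp only [endsProd, alternatingProd, endRatio, inv_div, mul_div_assoc]
    ring
  · rw [weightedTilingsK_eq_pairProd, ← isProductData_weightedTilingsK.endsProd_eq_pairProd hs]
    simp only [endsProd, alternatingProd, endRatio, inv_div, mul_div_assoc]
    ring
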